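/- Write $[M]=\{0,1,\dots,M-1\}$. The type of $x\in[M]^n$ is the multiset $\{x_1,\dots,x_n\}$ of its entries. For a partial function $f:X\to\{0,1\}$ with promise $X\subseteq[M]^n$, let $D(f)$ be the deterministic query complexity of $f$ (the least worst-case number, over inputs in $X$, of adaptive queries to entries of the input made by a deterministic decision tree that outputs $f(x)$ on every $x\in X$). Let $R(f)$ be its bounded-error randomized query complexity (the least $q$ such that some probability distribution over decision trees, each making at most $q$ queries on every $x\in X$, outputs $f(x)$ with error probability at most $1/3$ for every $x\in X$). Let $Q(f)$ be its bounded-error quantum query complexity (the least $q$ such that some quantum algorithm $U_qO_xU_{q-1}O_x\cdots U_1O_xU_0$ on a finite-dimensional space, started in a fixed basis state and ending with a measurement, outputs $f(x)$ with error probability at most $1/3$ for every $x\in X$, where the $U_j$ are unitaries independent of $x$ and $O_x$ is the query map $|i,b,w\rangle\mapsto|i,b+x_i \bmod M,w\rangle$, acting as the identity on a null index). Theorem. There is an absolute constant $c>0$ such that for all $n$ and $M$, every $T\subseteq[M]^n$ that consists of all inputs of one fixed type (equivalently, every orbit of the action of $S_n$ on $[M]^n$ by permuting the coordinates), and every $f:T\to\{0,1\}$,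 $$R(f)\ \ge\ c\,D(f)^{1/6}\qquad\text{and}\qquad Q(f)\ \ge\ c\,D(f)^{1/12}.$$ -/

import Mathlib

open scoped ENNReal NNReal

namespace QueryComplexity

/-- Inputs: strings of length `n` over the alphabet `[M] = {0, ..., M - 1}`. -/
abbrev Input (n M : ℕ) : Type := Fin n → Fin M

/-- The type of an input `x` is the multiset `{x_1, ..., x_n}` of its entries. -/
def inputType {n M : ℕ} (x : Input n M) : Multiset (Fin M) :=
  (Finset.univ : Finset (Fin n)).val.map x

/-- `T` is the set of all inputs whose type is the type of some given input. -/
def IsTypePromise {n M : ℕ} (T : Set (Input n M)) : Prop :=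
  ∃ x₀ : Input n M, T = {x | inputType x = inputType x₀}

/-! ### Deterministic algorithms -/

/-- Deterministic adaptive query algorithms: either output a bit, or query one entry of the input
and continue according to the answer. -/
inductive DecisionTree (n M : ℕ) : Type
  | output (b : Bool) : DecisionTree n M
  | query (i : Fin n) (next : Fin M → DecisionTree n M) : DecisionTree n M

namespace DecisionTree

/-- The output on input `x`. -/
def eval {n M : ℕ} : DecisionTree n M → Input n M → Bool
  | output b, _ => b
  | query i next, x => (next (x i)).eval x

/-- The number of queries made on input `x`. -/
def cost {n M : ℕ} : DecisionTree n M → Input n M → ℕ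
  | output _, _ => 0
  | query i next, x => (next (x i)).cost x + 1

end DecisionTree

/-- Some deterministic algorithm computes the partial function `f` on its whole promise `X` with
at most `q` queries on every input in `X`. -/
def DetComputable {n M : ℕ} {X : Set (Input n M)} (f : X → Bool) (q : ℕ) : Prop :=
  ∃ t : DecisionTree n M, ∀ x : X, t.eval x = f x ∧ t.cost x ≤ q

/-- The deterministic query complexity `D(f)`. -/
noncomputable def detComplexity {n M : ℕ} {X : Set (Input n M)} (f : X → Bool) : ℕ∞ :=
  ⨅ (q : ℕ) (_ : DetComputable f q), (q : ℕ∞)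

/-! ### Randomized algorithms -/

/-- Some randomized algorithm (a probability distribution over deterministic ones) computes `f`
with error probability at most `1/3` on every input in the promise `X`, never making more than
`q` queries on such an input. -/
def RandComputable {n M : ℕ} {X : Set (Input n M)} (f : X → Bool) (q : ℕ) : Prop :=
  ∃ μ : PMF (DecisionTree n M), ∀ x : X,
    μ.toOuterMeasure {t | t.eval x ≠ f x} ≤ 1 / 3 ∧ ∀ t ∈ μ.support, t.cost x ≤ q

/-- The bounded-error randomized query complexity `R(f)`. -/
noncomputable def randComplexity {n M : ℕ} {X : Set (Input n M)} (f : X → Bool) : ℕ∞ :=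
  ⨅ (q : ℕ) (_ : RandComputable f q), (q : ℕ∞)

/-! ### Quantum algorithms -/

/-- Computational basis `|i, b, w⟩`: a query index `i` (`none` is the null query), an answer
register `b ∈ [M]`, and a workspace register `w` of arbitrary finite dimension `d`. -/
abbrev QBasis (n M d : ℕ) : Type := Option (Fin n) × Fin M × Fin d

/-- The query to the input `x`, that is, the unitary map
`|i, b, w⟩ ↦ |i, b + x_i mod M, w⟩`, which does nothing for the null query.
It acts on a vector of amplitudes; subtraction in `Fin M` is modulo `M`. -/
def oracle {n M d : ℕ} (x : Input n M) (ψ : QBasis n M d → ℂ) : QBasis n M d → ℂ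
  | (none, b, w) => ψ (none, b, w)
  | (some i, b, w) => ψ (some i, b - x i, w)

/-- A quantum query algorithm: a finite-dimensional workspace, a basis state to start from,
input-independent unitaries `U 0, ..., U queries`, and the bit that is output for each outcome
of the final measurement in the computational basis. -/
structure QuantumAlgorithm (n M : ℕ) where
  queries : ℕ
  d : ℕ
  start : QBasis n M d
  U : Fin (queries + 1) → Matrix.unitaryGroup (QBasis n M d) ℂ
  out : QBasis n M d → Bool

namespace QuantumAlgorithm

/-- The state after `k` queries and the unitary that follows the last of them:
`U_k O_x U_{k-1} O_x ... U_1 O_x U_0 |start⟩`. -/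
noncomputable def stateAfter {n M : ℕ} (A : QuantumAlgorithm n M) (x : Input n M) :
    (k : ℕ) → k < A.queries + 1 → QBasis n M A.d → ℂ
  | 0, h => (A.U ⟨0, h⟩ : Matrix _ _ ℂ).mulVec (Pi.single A.start 1)
  | k + 1, h => (A.U ⟨k + 1, h⟩ : Matrix _ _ ℂ).mulVec
      (oracle x (A.stateAfter x k (Nat.lt_of_succ_lt h)))

/-- The probability that the algorithm outputs `b` on input `x`. -/
noncomputable def outputProb {n M : ℕ} (A : QuantumAlgorithm n M) (x : Input n M) (b : Bool) : ℝ :=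
  ∑ s : QBasis n M A.d,
    if A.out s = b then ‖A.stateAfter x A.queries (Nat.lt_succ_self _) s‖ ^ 2 else 0

end QuantumAlgorithm

/-- Some quantum algorithm with `q` queries computes `f` with error probability at most `1/3` on
every input in the promise `X`. -/
def QuantumComputable {n M : ℕ} {X : Set (Input n M)} (f : X → Bool) (q : ℕ) : Prop :=
  ∃ A : QuantumAlgorithm n M, A.queries = q ∧ ∀ x : X, A.outputProb x (!(f x)) ≤ 1 / 3

/-- The bounded-error quantum query complexity `Q(f)`. -/
noncomputable def quantumComplexity {n M : ℕ} {X : Set (Input n M)} (f : X → Bool) : ℕ∞ :=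
  ⨅ (q : ℕ) (_ : QuantumComputable f q), (q : ℕ∞)

end QueryComplexity

namespace QueryComplexity

/-! Randomized and quantum algorithms enter only through `QueryWeights`: an acceptance probability
and query weights of total mass W, defined on every string, also outside the promise, such that
changes on light sets barely move the probability. W is O(q) for randomized and O(q²) for quantum
algorithms, so a deterministic upper bound O(W⁶) (`QueryWeights.detComputable`) suffices. Writing an
input as x₀ ∘ π reduces that bound to functions on permutations (`exists_tree_perm`,
`DecisionTree.exists_simulation`).

On permutations, minimal sensitive blocks have size O(W) and at most W blocks are disjoint, so every
input has a certificate of size O(W²). The classical algorithm queries certificates repeatedly,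
because certificates of opposite values must clash. Here they may clash merely by placing one value
at two positions (`certificates_conflict`), which is no progress if that value was used before.
Hence each new certificate has to avoid, off the queried positions, the set V of values of the
earlier ones (`exists_certificate_avoiding`). Then each certificate opposing the true answer meets a
new position or a new value of a fixed true certificate, so there are only O(W²) of them, and a
majority vote decides.

Such certificates exist because values can be hidden. Put the values of V that are not fixed by the
queried positions on a random block U among many blocks of equal size, and overwrite U and m other
blocks by fixed entries. The resulting string does not reveal which of the m + 1 blocks is U, so U
carries weight at most W / (m + 1) on average. This string, no longer a permutation, serves as a
hybrid between x and its sensitive neighbours. It shows that few neighbours can differ from x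
disjointly outside U (`card_blocks_le_of_average`), and a greedy certificate can then avoid U.
Hiding needs n of order W⁶; for smaller n all entries are queried. -/

/-- The positions at which two inputs differ. -/
def diffSet {n M : ℕ} (x y : Input n M) : Finset (Fin n) :=
  Finset.univ.filter fun i => x i ≠ y i

@[simp]
theorem mem_diffSet {n M : ℕ} {x y : Input n M} {i : Fin n} :
    i ∈ diffSet x y ↔ x i ≠ y i := by simp [diffSet]

/-! ### Query weights, a common abstraction of randomized and quantum algorithms -/

/-- Query weights of total mass at most `W` for the partial function that sends `e a` to `f a`.
The acceptance probability `p` and the weights `w` are defined on all inputs, and `p` is stable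
under changes of `x` on sets of weight less than one. -/
structure QueryWeights {n M : ℕ} {ι : Type*} (e : ι → Input n M) (f : ι → Bool) (W : ℕ) where
  p : Input n M → ℝ
  w : Input n M → Fin n → ℝ
  nonneg : ∀ x i, 0 ≤ w x i
  sum_le : ∀ x, ∑ i, w x i ≤ W
  stable : ∀ x y, ∑ i ∈ diffSet x y, w x i < 1 → |p x - p y| < 1 / 12
  separated : ∀ a b, f a ≠ f b → 1 / 3 ≤ |p (e a) - p (e b)|

namespace QueryWeights

section General

variable {n M W : ℕ} {ι : Type*} {e : ι → Input n M} {f : ι → Bool}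

theorem sum_finset_le (H : QueryWeights e f W)
    (x : Input n M) (s : Finset (Fin n)) : ∑ i ∈ s, H.w x i ≤ W :=
  (Finset.sum_le_sum_of_subset_of_nonneg (Finset.subset_univ s)
    fun i _ _ => H.nonneg x i).trans (H.sum_le x)

theorem sum_mono (H : QueryWeights e f W) (x : Input n M) {s t : Finset (Fin n)} (h : s ⊆ t) :
    ∑ i ∈ s, H.w x i ≤ ∑ i ∈ t, H.w x i :=
  Finset.sum_le_sum_of_subset_of_nonneg h fun i _ _ => H.nonneg x i

theorem sum_disjoint_le (H : QueryWeights e f W)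
    (x : Input n M) {κ : Type*} [Fintype κ] [DecidableEq κ]
    (B : κ → Finset (Fin n)) (hB : Pairwise fun j k => Disjoint (B j) (B k)) :
    ∑ j, ∑ i ∈ B j, H.w x i ≤ W := by
  rw [← Finset.sum_biUnion (fun j _ k _ hjk => hB hjk)]
  exact H.sum_finset_le x _

theorem stable_of_subset (H : QueryWeights e f W)
    {x y : Input n M} {s : Finset (Fin n)} (h : diffSet x y ⊆ s)
    (hs : ∑ i ∈ s, H.w x i < 1) : |H.p x - H.p y| < 1 / 12 :=
  H.stable x y ((H.sum_mono x h).trans_lt hs)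

theorem one_le_sum_diffSet (H : QueryWeights e f W) {a b : ι} (h : f a ≠ f b) :
    1 ≤ ∑ i ∈ diffSet (e a) (e b), H.w (e a) i := by
  by_contra hlt
  have h1 := H.stable (e a) (e b) (not_le.mp hlt)
  have h2 := H.separated a b h
  linarith

theorem pos_of_ne (H : QueryWeights e f W) {a b : ι} (h : f a ≠ f b) : 0 < W := by
  have h1 := (H.one_le_sum_diffSet h).trans (H.sum_finset_le _ _)
  exact_mod_cast lt_of_lt_of_le zero_lt_one h1

end General

/-- Query weights pull back along a relabelling of the alphabet. -/
def comap {n M N W : ℕ} {ι κ : Type*} {e : ι → Input n M} {f : ι → Bool}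
    (H : QueryWeights e f W) (φ : Fin N → Fin M) (e' : κ → Input n N) (r : κ → ι)
    (hr : ∀ k, e (r k) = φ ∘ e' k) : QueryWeights e' (f ∘ r) W where
  p x := H.p (φ ∘ x)
  w x := H.w (φ ∘ x)
  nonneg x i := H.nonneg _ i
  sum_le x := H.sum_le _
  stable x y h := by
    refine H.stable_of_subset (s := diffSet x y) ?_ h
    intro i
    simp only [mem_diffSet, Function.comp_apply]
    exact fun h1 h2 => h1 (by rw [h2])
  separated a b h := by
    rw [← hr, ← hr]
    exact H.separated _ _ h

/-! ### Sensitive blocks and certificates on permutations -/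

section Perm

variable {n W : ℕ} {f : Equiv.Perm (Fin n) → Bool}

/-- A sensitive block that is minimal outside `U` has at most `2 * W` elements outside `U`. -/
theorem card_minimal_block_le
    (H : QueryWeights (fun π : Equiv.Perm (Fin n) => (π : Input n n)) f W)
    {x y : Equiv.Perm (Fin n)} (U : Finset (Fin n)) (hxy : f y ≠ f x)
    (hmin : ∀ y' : Equiv.Perm (Fin n), f y' ≠ f x → ¬ diffSet x y' \ U ⊂ diffSet x y \ U) :
    (diffSet x y \ U).card ≤ 2 * W := by
  set B := diffSet x y \ U with hB
  have key : ∀ a ∈ B, 1 ≤ H.w y a + H.w y (y.symm (x a)) := by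
    intro a ha
    have hxa : x a ≠ y a := by
      simpa using (Finset.mem_sdiff.mp ha).1
    have haU := (Finset.mem_sdiff.mp ha).2
    -- Swapping the entries of `y` at `a` and `b` repairs position `a` and spoils nothing, since `x
    -- b ≠ x a = y b` already. By minimality the swap restores the value `f x`, so the pair carries
    -- weight at least 1 under `y`.
    set b := y.symm (x a) with hb
    have hyb : y b = x a := by simp [hb]
    have hba : b ≠ a := by rintro h; rw [h] at hyb; exact hxa hyb.symm
    set y' : Equiv.Perm (Fin n) := (Equiv.swap a b).trans y with hy'
    have hy'a : y' a = x a := by simp [hy', hyb]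
    have hy'c : ∀ c, c ≠ a → c ≠ b → y' c = y c := by
      intro c h1 h2
      simp [hy', Equiv.swap_apply_of_ne_of_ne h1 h2]
    have hss : diffSet x y' \ U ⊂ B := by
      rw [Finset.ssubset_iff_of_subset]
      · exact ⟨a, ha, by simp [hy'a]⟩
      · intro c hc
        rw [Finset.mem_sdiff, mem_diffSet] at hc
        rw [hB, Finset.mem_sdiff, mem_diffSet]
        refine ⟨?_, hc.2⟩
        by_cases h1 : c = a
        · subst h1; exact hxa
        by_cases h2 : c = b
        · subst h2; rw [hyb]; exact fun h => hba (x.injective h)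
        · rw [← hy'c c h1 h2]; exact hc.1
    have hf : f y' = f x := by
      by_contra h
      exact hmin y' h hss
    have h1 := H.one_le_sum_diffSet (a := y) (b := y') (by rw [hf]; exact hxy)
    have h2 : diffSet (y : Input n n) y' ⊆ {a, b} := by
      intro c
      rw [mem_diffSet, Finset.mem_insert, Finset.mem_singleton]
      intro hc
      by_contra hcon
      push Not at hcon
      exact hc (hy'c c hcon.1 hcon.2).symm
    have h3 := h1.trans (H.sum_mono y h2)
    rwa [Finset.sum_pair hba.symm] at h3
  -- Both `a` and `y.symm (x a)` run through distinct positions, so each of the two sums is at most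
  -- `W`.
  have h1 : (B.card : ℝ) ≤ ∑ a ∈ B, (H.w y a + H.w y (y.symm (x a))) := by
    simpa using Finset.card_nsmul_le_sum B _ 1 key
  rw [Finset.sum_add_distrib] at h1
  have h2 : ∑ a ∈ B, H.w y (y.symm (x a)) = ∑ a ∈ B.map (x.trans y.symm).toEmbedding, H.w y a := by
    simp
  rw [h2] at h1
  have h3 := H.sum_finset_le y B
  have h4 := H.sum_finset_le y (B.map (x.trans y.symm).toEmbedding)
  have h5 : (B.card : ℝ) ≤ ((2 * W : ℕ) : ℝ) := by push_cast; linarith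
  exact_mod_cast h5

/-- If sensitive blocks of `x` that are disjoint outside `U` are few, then `x` has a small
certificate that avoids `U`. -/
theorem exists_certificate
    (H : QueryWeights (fun π : Equiv.Perm (Fin n) => (π : Input n n)) f W)
    (x : Equiv.Perm (Fin n)) (U : Finset (Fin n)) (N : ℕ)
    (hN : ∀ (k : ℕ) (y : Fin k → Equiv.Perm (Fin n)), (∀ j, f (y j) ≠ f x) →
      (Pairwise fun i j => Disjoint (diffSet x (y i) \ U) (diffSet x (y j) \ U)) → k ≤ N) :
    ∃ P : Finset (Fin n), Disjoint P U ∧ P.card ≤ N * (2 * W) ∧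
      ∀ y : Equiv.Perm (Fin n), (∀ i ∈ P, y i = x i) → f y = f x := by
  by_contra hno
  have key : ∀ k : ℕ, ∃ y : Fin k → Equiv.Perm (Fin n), (∀ j, f (y j) ≠ f x) ∧
      (Pairwise fun i j => Disjoint (diffSet x (y i) \ U) (diffSet x (y j) \ U)) ∧
      ∀ j, (diffSet x (y j) \ U).card ≤ 2 * W := by
    intro k
    induction k with
    | zero => exact ⟨fun j => j.elim0, fun j => j.elim0, fun j => j.elim0, fun j => j.elim0⟩
    | succ k ih =>
      obtain ⟨y, hy, hd, hc⟩ := ih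
      set P := Finset.univ.biUnion fun j => diffSet x (y j) \ U with hP
      have hPU : Disjoint P U := by
        rw [hP, Finset.disjoint_biUnion_left]
        exact fun j _ => Finset.sdiff_disjoint
      have hPc : P.card ≤ N * (2 * W) := by
        calc P.card ≤ ∑ j : Fin k, (diffSet x (y j) \ U).card := Finset.card_biUnion_le
          _ ≤ ∑ j : Fin k, 2 * W := Finset.sum_le_sum fun j _ => hc j
          _ = k * (2 * W) := by simp
          _ ≤ N * (2 * W) := Nat.mul_le_mul_right _ (hN k y hy hd)
      -- The union `P` of the blocks is small and avoids `U`, so failing to be a certificate it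
      -- leaves room for one more block. Shrinking that block to a minimal one keeps it disjoint
      -- from `P`.
      have : ∃ y : Equiv.Perm (Fin n), (∀ i ∈ P, y i = x i) ∧ f y ≠ f x := by
        by_contra hcon
        push Not at hcon
        exact hno ⟨P, hPU, hPc, hcon⟩
      obtain ⟨y₀, hy₀, hfy₀⟩ := this
      obtain ⟨y₁, ⟨hy₁f, hy₁s⟩, hy₁m⟩ := (measure fun z : Equiv.Perm (Fin n) =>
        (diffSet x z \ U).card).wf.has_min
        {z | f z ≠ f x ∧ diffSet x z \ U ⊆ diffSet x y₀ \ U} ⟨y₀, hfy₀, subset_rfl⟩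
      have hdis : ∀ j, Disjoint (diffSet x y₁ \ U) (diffSet x (y j) \ U) := by
        intro j
        rw [Finset.disjoint_left]
        intro i hi hij
        have h1 := hy₁s hi
        rw [Finset.mem_sdiff, mem_diffSet] at h1
        refine h1.1 (hy₀ i ?_).symm
        rw [hP, Finset.mem_biUnion]
        exact ⟨j, Finset.mem_univ _, hij⟩
      refine ⟨Fin.cons y₁ y, ?_, ?_, ?_⟩
      · intro j
        refine Fin.cases ?_ (fun j => ?_) j
        · simpa using hy₁f
        · simpa using hy j
      · intro i j
        refine Fin.cases ?_ (fun i => ?_) i <;> refine Fin.cases ?_ (fun j => ?_) j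
        · intro h; exact absurd rfl h
        · intro _; simpa using hdis j
        · intro _; simpa using (hdis i).symm
        · intro h
          simpa using hd (fun h' => h (by rw [h']))
      · intro j
        refine Fin.cases ?_ (fun j => ?_) j
        · simp only [Fin.cons_zero]
          refine H.card_minimal_block_le U hy₁f fun y' hy' hlt => ?_
          exact hy₁m y' ⟨hy', hlt.1.trans hy₁s⟩ (Finset.card_lt_card hlt)
        · simpa using hc j
  obtain ⟨y, hy, hd, -⟩ := key (N + 1)
  exact absurd (hN (N + 1) y hy hd) (by omega)

/-- Every permutation has a certificate of size at most `2 * W ^ 2`. -/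
theorem exists_certificate_all
    (H : QueryWeights (fun π : Equiv.Perm (Fin n) => (π : Input n n)) f W)
    (x : Equiv.Perm (Fin n)) :
    ∃ P : Finset (Fin n), P.card ≤ W * (2 * W) ∧
      ∀ y : Equiv.Perm (Fin n), (∀ i ∈ P, y i = x i) → f y = f x := by
  obtain ⟨P, -, h2, h3⟩ := H.exists_certificate x ∅ W fun k y hy hd => by
    simp only [Finset.sdiff_empty] at hd
    have h1 := H.sum_disjoint_le x (fun j => diffSet x (y j)) hd
    have h2 : (k : ℝ) ≤ ∑ j : Fin k, ∑ i ∈ diffSet x (y j), H.w x i := by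
      simpa using Finset.card_nsmul_le_sum (Finset.univ : Finset (Fin k)) _ 1
        fun j _ => H.one_le_sum_diffSet (a := x) (b := y j) (hy j).symm
    exact_mod_cast h2.trans h1
  exact ⟨P, h2, h3⟩

end Perm

end QueryWeights

/-! ### Overwritten inputs and permutations of blocks -/

/-- Overwrite the entries of `x` in `E` by entries that do not depend on `x`. -/
def fill {n : ℕ} (E : Finset (Fin n)) (x : Input n n) : Input n n :=
  fun i => if i ∈ E then i else x i

theorem diffSet_fill_subset {n : ℕ} (E : Finset (Fin n)) (x : Input n n) :
    diffSet x (fill E x) ⊆ E := by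
  intro i
  rw [mem_diffSet]
  contrapose!
  intro h
  simp [fill, h]

/-- Overwriting `E` on both sides erases every difference there, and overwriting `U` on one side
only can create differences inside `U` alone. -/
theorem diffSet_fill_union_fill_subset {n : ℕ} (E U : Finset (Fin n)) (x y : Input n n) :
    diffSet (fill (E ∪ U) x) (fill E y) ⊆ U ∪ (diffSet x y \ U) := by
  intro i
  rw [mem_diffSet]
  contrapose!
  intro h
  simp only [Finset.mem_union, Finset.mem_sdiff, mem_diffSet, not_or, not_and, not_not] at h
  by_cases hE : i ∈ E
  · simp [fill, hE]
  · have hx : x i = y i := by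
      by_contra hne
      exact h.1 (h.2 hne)
    simp [fill, hE, h.1, hx]

section Blocks

variable {n : ℕ} {κ ι : Type} [Fintype κ] (φ : ι × κ ↪ Fin n)

/-- The block of positions with index `b`. -/
def block (b : ι) : Finset (Fin n) :=
  Finset.univ.map ⟨fun u => φ (b, u), fun _ _ h => (Prod.mk.inj (φ.injective h)).2⟩

theorem mem_block {b : ι} {i : Fin n} : i ∈ block φ b ↔ ∃ u, φ (b, u) = i := by
  simp only [block, Finset.mem_map, Finset.mem_univ, true_and]
  rfl

theorem apply_mem_block {b c : ι} {u : κ} : φ (c, u) ∈ block φ b ↔ c = b := by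
  rw [mem_block]
  constructor
  · rintro ⟨v, hv⟩
    exact (Prod.mk.inj (φ.injective hv)).1.symm
  · rintro rfl
    exact ⟨u, rfl⟩

theorem disjoint_block {b c : ι} (h : b ≠ c) : Disjoint (block φ b) (block φ c) := by
  rw [Finset.disjoint_left]
  intro i hib hic
  obtain ⟨u, rfl⟩ := (mem_block φ).mp hib
  exact h ((apply_mem_block φ).mp hic)

/-- The permutation of positions that permutes whole blocks. -/
noncomputable def blockPerm [Fintype ι] (g : Equiv.Perm ι) : Equiv.Perm (Fin n) :=
  letI := Classical.decEq κ
  Equiv.Perm.viaFintypeEmbedding (Equiv.prodCongr g (Equiv.refl κ)) φ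

theorem blockPerm_apply [Fintype ι] (g : Equiv.Perm ι) (b : ι) (u : κ) :
    blockPerm φ g (φ (b, u)) = φ (g b, u) := by
  classical
  simp [blockPerm, Equiv.Perm.viaFintypeEmbedding_apply_image]

theorem blockPerm_apply_of_notMem [Fintype ι] (g : Equiv.Perm ι) {i : Fin n} (hi : i ∉ Set.range φ) :
    blockPerm φ g i = i := by
  classical
  exact Equiv.Perm.viaFintypeEmbedding_apply_notMem_range _ _ hi

end Blocks

/-! ### Hiding values by averaging over their places -/

namespace QueryWeights

variable {n W : ℕ} {f : Equiv.Perm (Fin n) → Bool}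

/-- Suppose that `x` and the overwritten inputs put little weight on `E l` and on `U`, on average
over `l`. Then `x` has few sensitive blocks that are disjoint outside `U`. -/
theorem card_blocks_le_of_average
    (H : QueryWeights (fun π : Equiv.Perm (Fin n) => (π : Input n n)) f W)
    {L m : ℕ} (hL : L = 6 * W + 1) (hm : m = 3 * W)
    (x : Equiv.Perm (Fin n)) (U : Finset (Fin n)) (E : Fin L → Finset (Fin n))
    (hE : Pairwise fun l l' => Disjoint (E l) (E l'))
    (hU : ∑ l, (m + 1 : ℝ) * ∑ i ∈ U, H.w (fill (E l ∪ U) x) i ≤ L * W)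
    (k : ℕ) (y : Fin k → Equiv.Perm (Fin n)) (hy : ∀ j, f (y j) ≠ f x)
    (hd : Pairwise fun i j => Disjoint (diffSet x (y i) \ U) (diffSet x (y j) \ U)) :
    k ≤ 3 * W := by
  by_contra hk
  rw [not_le] at hk
  have hkR : (3 * W + 1 : ℝ) ≤ k := by exact_mod_cast hk
  have hLR : (L : ℝ) = 6 * W + 1 := by exact_mod_cast hL
  have hmR : (m : ℝ) = 3 * W := by exact_mod_cast hm
  have hWR : (0 : ℝ) ≤ W := Nat.cast_nonneg W
  set A : Fin L → ℝ := fun l => ∑ i ∈ E l, H.w x i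
  set B : Fin L → Fin k → ℝ := fun l j => ∑ i ∈ E l, H.w (y j) i
  set C : Fin L → ℝ := fun l => ∑ i ∈ U, H.w (fill (E l ∪ U) x) i
  set D : Fin L → Fin k → ℝ := fun l j => ∑ i ∈ diffSet x (y j) \ U, H.w (fill (E l ∪ U) x) i
  have hA : ∑ l, A l ≤ W := H.sum_disjoint_le x E hE
  have hB : ∀ j, ∑ l, B l j ≤ W := fun j => H.sum_disjoint_le (y j) E hE
  have hC : (3 * W + 1 : ℝ) * ∑ l, C l ≤ L * W := by
    rw [Finset.mul_sum, ← hmR]; exact hU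
  have hD : ∀ l, ∑ j, D l j ≤ W := fun l => H.sum_disjoint_le _ _ hd
  -- On average over the pairs, `A` and `B` are at most `W / L`, `C` at most `W / (m + 1)` and `D`
  -- at most `W / k`. The choices of `L` and `m` and the assumption `3 * W < k` make the total less
  -- than 1/3 + 1/3 + 1/3.
  have hsum : ∑ q : Fin L × Fin k, (A q.1 + B q.1 q.2 + C q.1 + D q.1 q.2)
      < ∑ _q : Fin L × Fin k, (1 : ℝ) := by
    have e1 : ∑ q : Fin L × Fin k, (A q.1 + B q.1 q.2 + C q.1 + D q.1 q.2)
        = k * ∑ l, A l + ∑ j, ∑ l, B l j + k * ∑ l, C l + ∑ l, ∑ j, D l j := by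
      simp only [Finset.sum_add_distrib, Fintype.sum_prod_type, Finset.sum_const,
        Finset.card_univ, Fintype.card_fin, nsmul_eq_mul, ← Finset.mul_sum]
      congr 3
      exact Finset.sum_comm
    have e2 : ∑ j, ∑ l, B l j ≤ k * W := by
      simpa using Finset.sum_le_sum fun (j : Fin k) (_ : j ∈ Finset.univ) => hB j
    have e3 : ∑ l, ∑ j, D l j ≤ L * W := by
      simpa using Finset.sum_le_sum fun (l : Fin L) (_ : l ∈ Finset.univ) => hD l
    have e4 : (k : ℝ) * ∑ l, A l ≤ k * W := by gcongr
    have hLpos : (0 : ℝ) < L := by rw [hLR]; linarith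
    have hkpos : (0 : ℝ) < k := by linarith
    have e5 : ∑ l, C l ≤ L / 3 := by
      by_contra hcon
      rw [not_le] at hcon
      nlinarith
    have e6 : (k : ℝ) * ∑ l, C l ≤ k * (L / 3) := by gcongr
    have e7 : (k : ℝ) * W + k * W < k * (L / 3) := by rw [hLR]; nlinarith
    have e8 : (L : ℝ) * W ≤ L * (k / 3) := by
      gcongr; linarith
    rw [e1]
    simp only [Finset.sum_const, Finset.card_univ, Fintype.card_prod, Fintype.card_fin,
      nsmul_eq_mul, mul_one, Nat.cast_mul]
    linarith
  obtain ⟨⟨l, j⟩, -, hlj⟩ := Finset.exists_lt_of_sum_lt hsum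
  simp only at hlj
  have nA : 0 ≤ A l := Finset.sum_nonneg fun i _ => H.nonneg _ i
  have nB : 0 ≤ B l j := Finset.sum_nonneg fun i _ => H.nonneg _ i
  have nC : 0 ≤ C l := Finset.sum_nonneg fun i _ => H.nonneg _ i
  have nD : 0 ≤ D l j := Finset.sum_nonneg fun i _ => H.nonneg _ i
  -- The path from `x` to `y j`: overwrite `E l`, overwrite `U`, pass to `y j` with `E l`
  -- overwritten, restore `E l`. Four moves of less than 1/12 each contradict the separation 1/3.
  have s1 := H.stable_of_subset (diffSet_fill_subset (E l) x) (by linarith : A l < 1)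
  have s2 := H.stable_of_subset (diffSet_fill_subset (E l) (y j)) (by linarith : B l j < 1)
  have s3 := H.stable_of_subset (x := fill (E l ∪ U) x) (y := fill (E l) x) (s := U)
    ((diffSet_fill_union_fill_subset (E l) U x x).trans (by
      intro i; simp)) (by linarith : C l < 1)
  have s4 := H.stable_of_subset (diffSet_fill_union_fill_subset (E l) U x (y j)) (by
    rw [Finset.sum_union Finset.disjoint_sdiff]
    linarith : ∑ i ∈ U ∪ (diffSet x (y j) \ U), H.w (fill (E l ∪ U) x) i < 1)
  have s5 := H.separated x (y j) (hy j).symm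
  simp only [abs_lt] at s1 s2 s3 s4
  have : |H.p x - H.p (y j)| < 1 / 3 := by
    rw [abs_lt]; constructor <;> linarith [s1.1, s1.2, s2.1, s2.2, s3.1, s3.2, s4.1, s4.2]
  linarith

/-- Given the entries of `a` in `S`, and few further positions `U₀`, some permutation that agrees
with `a` on `S` has few sensitive blocks disjoint outside the places of the values `a '' U₀`. -/
theorem exists_few_blocks
    (H : QueryWeights (fun π : Equiv.Perm (Fin n) => (π : Input n n)) f W)
    (a : Equiv.Perm (Fin n)) (S U₀ : Finset (Fin n)) (hSU : Disjoint S U₀)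
    (hn : S.card + U₀.card * (1 + (6 * W + 1) * (3 * W)) ≤ n) :
    ∃ (z : Equiv.Perm (Fin n)) (U : Finset (Fin n)), (∀ i ∈ S, z i = a i) ∧
      (∀ i, ∀ u ∈ U₀, z i = a u → i ∈ U) ∧
      ∀ (k : ℕ) (y : Fin k → Equiv.Perm (Fin n)), (∀ j, f (y j) ≠ f z) →
        (Pairwise fun i j => Disjoint (diffSet z (y i) \ U) (diffSet z (y j) \ U)) →
        k ≤ 3 * W := by
  classical
  obtain ⟨L, hL⟩ : ∃ L, L = 6 * W + 1 := ⟨_, rfl⟩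
  obtain ⟨m, hm⟩ : ∃ m, m = 3 * W := ⟨_, rfl⟩
  rw [← hL, ← hm] at hn
  obtain ⟨ψ⟩ : Nonempty ((Fin L × Fin m) × U₀ ↪ ((S ∪ U₀)ᶜ : Finset (Fin n))) := by
    apply Function.Embedding.nonempty_of_card_le
    simp only [Fintype.card_prod, Fintype.card_fin, Fintype.card_coe, Finset.card_compl]
    rw [Finset.card_union_of_disjoint hSU]
    have : U₀.card * (1 + L * m) = U₀.card + L * m * U₀.card := by ring
    omega
  have hψ : ∀ q, (ψ q : Fin n) ∉ S ∧ (ψ q : Fin n) ∉ U₀ := by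
    intro q
    have := (ψ q).2
    rw [Finset.mem_compl, Finset.mem_union, not_or] at this
    exact this
  -- The block with index `none` is `U₀` itself; the others are `L * m` disjoint copies of it
  -- outside `S ∪ U₀`.
  let φf : Option (Fin L × Fin m) × U₀ → Fin n := fun q => q.1.elim q.2.1 fun b => ψ (b, q.2)
  have hφf : Function.Injective φf := by
    rintro ⟨_ | b, u⟩ ⟨_ | c, v⟩ h
    · simp only [φf, Option.elim] at h
      rw [Subtype.ext h]
    · simp only [φf, Option.elim] at h
      exact absurd u.2 (by rw [h]; exact (hψ _).2)
    · simp only [φf, Option.elim] at h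
      exact absurd v.2 (by rw [← h]; exact (hψ _).2)
    · simp only [φf, Option.elim] at h
      have := ψ.injective (Subtype.ext h)
      simp only [Prod.mk.injEq] at this
      rw [this.1, this.2]
  let φ : Option (Fin L × Fin m) × U₀ ↪ Fin n := ⟨φf, hφf⟩
  have hφS : ∀ i ∈ S, i ∉ Set.range φ := by
    rintro i hi ⟨⟨_ | b, u⟩, rfl⟩
    · exact Finset.disjoint_left.mp hSU hi u.2
    · exact (hψ (b, u)).1 hi
  let x : Equiv.Perm (Option (Fin L × Fin m)) → Equiv.Perm (Fin n) :=
    fun g => (blockPerm φ g).trans a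
  let E : Equiv.Perm (Option (Fin L × Fin m)) → Fin L → Finset (Fin n) :=
    fun g l => Finset.univ.biUnion fun j => block φ (g.symm (some (l, j)))
  let U : Equiv.Perm (Option (Fin L × Fin m)) → Finset (Fin n) := fun g => block φ (g.symm none)
  let zs : Equiv.Perm (Option (Fin L × Fin m)) → Fin L → Input n n :=
    fun g l => fill (E g l ∪ U g) (x g)
  let pos : Fin L → Option (Fin m) → Option (Fin L × Fin m) := fun l o => o.map fun j => (l, j)
  have hmem : ∀ g l b u, φ (b, u) ∈ E g l ∪ U g ↔ ∃ o, g b = pos l o := by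
    intro g l b u
    simp only [E, U, pos, Finset.mem_union, Finset.mem_biUnion, apply_mem_block,
      Equiv.eq_symm_apply, Finset.mem_univ, true_and]
    constructor
    · rintro (⟨j, hj⟩ | h)
      · exact ⟨some j, hj⟩
      · exact ⟨none, h⟩
    · rintro ⟨_ | j, h⟩
      · exact Or.inr h
      · exact Or.inl ⟨j, h⟩
  have hnotmem : ∀ g l i, i ∉ Set.range φ → i ∉ E g l ∪ U g := by
    intro g l i hi
    simp only [E, U, Finset.mem_union, Finset.mem_biUnion, mem_block, not_or, not_exists]
    exact ⟨fun j ⟨_, _, hu⟩ => hi ⟨_, hu⟩, fun u hu => hi ⟨_, hu⟩⟩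
  -- This is the hiding: exchanging `U` with a block of `E l` only permutes content that is
  -- overwritten anyway.
  have hinv : ∀ g l o, zs (Equiv.swap none (pos l o) * g) l = zs g l := by
    intro g l o
    funext i
    by_cases hi : i ∈ Set.range φ
    · obtain ⟨⟨b, u⟩, rfl⟩ := hi
      have hiff : (∃ o', (Equiv.swap none (pos l o) * g) b = pos l o') ↔ ∃ o', g b = pos l o' := by
        rw [Equiv.Perm.mul_apply]
        by_cases h1 : g b = none
        · simp only [h1, Equiv.swap_apply_left]
          exact ⟨fun _ => ⟨none, rfl⟩, fun _ => ⟨o, rfl⟩⟩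
        by_cases h2 : g b = pos l o
        · simp only [h2, Equiv.swap_apply_right]
          exact ⟨fun _ => ⟨o, rfl⟩, fun _ => ⟨none, rfl⟩⟩
        · rw [Equiv.swap_apply_of_ne_of_ne h1 h2]
      simp only [zs, fill, hmem, hiff]
      split_ifs with h
      · rfl
      · simp only [x, Equiv.trans_apply, blockPerm_apply, Equiv.Perm.mul_apply]
        rw [Equiv.swap_apply_of_ne_of_ne]
        · exact fun h1 => h ⟨none, h1⟩
        · exact fun h1 => h ⟨o, h1⟩
    · simp only [zs, fill, hnotmem _ _ _ hi, if_false, x, Equiv.trans_apply]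
      rw [blockPerm_apply_of_notMem _ _ hi, blockPerm_apply_of_notMem _ _ hi]
  have hpos : ∀ l, Function.Injective (pos l) := by
    intro l
    apply Option.map_injective
    intro j j' h
    exact (Prod.mk.inj h).2
  have hshift : ∀ l o, ∑ g, ∑ i ∈ block φ (g.symm none), H.w (zs g l) i
      = ∑ g : Equiv.Perm (Option (Fin L × Fin m)),
        ∑ i ∈ block φ (g.symm (pos l o)), H.w (zs g l) i := by
    intro l o
    rw [← Equiv.sum_comp (Equiv.mulLeft (Equiv.swap none (pos l o)))]
    refine Finset.sum_congr rfl fun g _ => ?_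
    simp only [Equiv.coe_mulLeft, hinv]
    congr 2
  -- By `hshift` the factor `m + 1` may be spent on the `m + 1` blocks that could be `U`. They are
  -- disjoint, so together they weigh at most `W`.
  have havg : ∑ g, ∑ l, (m + 1 : ℝ) * ∑ i ∈ U g, H.w (zs g l) i
      ≤ ∑ _g : Equiv.Perm (Option (Fin L × Fin m)), (L * W : ℝ) := by
    calc ∑ g, ∑ l, (m + 1 : ℝ) * ∑ i ∈ U g, H.w (zs g l) i
        = ∑ l, (m + 1 : ℝ) * ∑ g, ∑ i ∈ U g, H.w (zs g l) i := by
          rw [Finset.sum_comm]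
          simp only [Finset.mul_sum]
      _ = ∑ l, ∑ o : Option (Fin m), ∑ g : Equiv.Perm (Option (Fin L × Fin m)),
            ∑ i ∈ block φ (g.symm (pos l o)), H.w (zs g l) i := by
          refine Finset.sum_congr rfl fun l _ => ?_
          rw [← Finset.sum_congr rfl fun o _ => hshift l o]
          simp [U]
      _ = ∑ g : Equiv.Perm (Option (Fin L × Fin m)), ∑ l, ∑ o : Option (Fin m),
            ∑ i ∈ block φ (g.symm (pos l o)), H.w (zs g l) i := by
          rw [Finset.sum_comm (s := (Finset.univ : Finset (Equiv.Perm _)))]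
          exact Finset.sum_congr rfl fun l _ => Finset.sum_comm
      _ ≤ ∑ _g : Equiv.Perm (Option (Fin L × Fin m)), ∑ _l : Fin L, (W : ℝ) := by
          refine Finset.sum_le_sum fun g _ => Finset.sum_le_sum fun l _ => ?_
          refine H.sum_disjoint_le _ _ fun o o' h => disjoint_block φ ?_
          exact fun h' => h (hpos l (g.symm.injective h'))
      _ = _ := by simp
  obtain ⟨g, -, hg⟩ := Finset.exists_le_of_sum_le Finset.univ_nonempty havg
  refine ⟨x g, U g, ?_, ?_, ?_⟩
  · intro i hi
    simp only [x, Equiv.trans_apply]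
    rw [blockPerm_apply_of_notMem _ _ (hφS i hi)]
  · intro i u hu h
    have h1 : blockPerm φ g i = φ (none, ⟨u, hu⟩) := a.injective h
    have h2 : blockPerm φ g (φ (g.symm none, ⟨u, hu⟩)) = φ (none, ⟨u, hu⟩) := by
      rw [blockPerm_apply, Equiv.apply_symm_apply]
    rw [← (blockPerm φ g).injective (h2.trans h1.symm)]
    exact (apply_mem_block φ).mpr rfl
  · refine H.card_blocks_le_of_average hL hm (x g) (U g) (E g) ?_ hg
    intro l l' hll
    simp only [E, Finset.disjoint_biUnion_left, Finset.disjoint_biUnion_right]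
    intro j _ j' _
    refine disjoint_block φ fun h => hll ?_
    have := g.symm.injective h
    simp only [Option.some.injEq, Prod.mk.injEq] at this
    exact this.1

/-- Given the entries of `a` in `S`, and few values `V`, there is a small certificate that is
compatible with these entries and that uses no value of `V` outside `S`. -/
theorem exists_certificate_avoiding
    (H : QueryWeights (fun π : Equiv.Perm (Fin n) => (π : Input n n)) f W)
    (a : Equiv.Perm (Fin n)) (S V : Finset (Fin n))
    (hn : S.card + V.card * (1 + (6 * W + 1) * (3 * W)) ≤ n) :
    ∃ (z : Equiv.Perm (Fin n)) (P : Finset (Fin n)), (∀ i ∈ S, z i = a i) ∧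
      (∀ i ∈ P, z i ∈ V → i ∈ S) ∧ P.card ≤ 3 * W * (2 * W) ∧
      ∀ y : Equiv.Perm (Fin n), (∀ i ∈ P, y i = z i) → f y = f z := by
  classical
  set U₀ : Finset (Fin n) := Finset.univ.filter fun i => i ∉ S ∧ a i ∈ V with hU₀
  have hcard : U₀.card ≤ V.card := by
    refine Finset.card_le_card_of_injOn a ?_ a.injective.injOn
    intro i hi
    simp only [hU₀, Finset.coe_filter, Set.mem_ofPred_eq] at hi
    exact hi.2.2
  have hSU : Disjoint S U₀ := by
    rw [Finset.disjoint_left]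
    intro i hi hi'
    exact (Finset.mem_filter.mp hi').2.1 hi
  obtain ⟨z, U, hzS, hzU, hz⟩ := H.exists_few_blocks a S U₀ hSU
    ((Nat.add_le_add_left (Nat.mul_le_mul_right _ hcard) _).trans hn)
  obtain ⟨P, hPU, hPc, hP⟩ := H.exists_certificate z U _ hz
  refine ⟨z, P, hzS, ?_, hPc, hP⟩
  intro i hi hzi
  by_contra hiS
  refine Finset.disjoint_left.mp hPU hi (hzU i (a.symm (z i)) ?_ (by simp))
  simp only [hU₀, Finset.mem_filter, Finset.mem_univ, true_and, Equiv.apply_symm_apply, hzi,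
    and_true]
  -- If the place of the value `z i` under `a` lay in `S`, then `z` would take this value there too,
  -- hence at `i` by injectivity, forcing `i ∈ S`.
  intro h
  have h1 := hzS _ h
  rw [Equiv.apply_symm_apply] at h1
  exact hiS (z.injective h1 ▸ h)

end QueryWeights

/-! ### Composing decision trees -/

namespace DecisionTree

/-- Query the positions in a list, record the answers in `acc`, and continue. -/
def queryList {n M : ℕ} : List (Fin n) → (Input n M → DecisionTree n M) → Input n M →
    DecisionTree n M
  | [], k, acc => k acc
  | i :: l, k, acc => query i fun v => queryList l k (Function.update acc i v)

theorem queryList_spec {n M : ℕ} (l : List (Fin n)) (k : Input n M → DecisionTree n M)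
    (acc x : Input n M) :
    ∃ acc' : Input n M, (∀ i, acc i = x i ∨ i ∈ l → acc' i = x i) ∧
      (queryList l k acc).eval x = (k acc').eval x ∧
      (queryList l k acc).cost x = (k acc').cost x + l.length := by
  induction l generalizing acc with
  | nil => exact ⟨acc, fun i h => by simpa using h, rfl, rfl⟩
  | cons j l ih =>
    obtain ⟨acc', h1, h2, h3⟩ := ih (Function.update acc j (x j))
    refine ⟨acc', ?_, h2, ?_⟩
    · intro i hi
      apply h1
      by_cases hij : i = j
      · subst hij; simp
      · simpa [hij] using hi
    · simp only [queryList, cost, h3, List.length_cons]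
      omega

/-- To compute `f` on the inputs in `X` that agree with `a` on `S`, it suffices to query the
positions in `P` and to compute `f` given the answers. -/
theorem exists_of_query {n M : ℕ} (X : Set (Input n M)) (f : Input n M → Bool)
    (S P : Finset (Fin n)) (a : Input n M) (q : ℕ)
    (h : ∀ b ∈ X, (∀ i ∈ S, b i = a i) → ∃ t : DecisionTree n M, ∀ x ∈ X,
      (∀ i ∈ S ∪ P, x i = b i) → t.eval x = f x ∧ t.cost x ≤ q) :
    ∃ t : DecisionTree n M, ∀ x ∈ X, (∀ i ∈ S, x i = a i) →
      t.eval x = f x ∧ t.cost x ≤ q + P.card := by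
  classical
  -- The recorded answers need not form an element of `X`, since they are arbitrary off `S ∪ P`. The
  -- continuation is therefore chosen by the existence of a suitable tree, with a dummy leaf when
  -- there is none.
  let k : Input n M → DecisionTree n M := fun b =>
    if h : ∃ t : DecisionTree n M, ∀ x ∈ X,
      (∀ i ∈ S ∪ P, x i = b i) → t.eval x = f x ∧ t.cost x ≤ q then h.choose else output true
  refine ⟨queryList P.toList k a, fun x hx hxa => ?_⟩
  obtain ⟨b, hb, he, hc⟩ := queryList_spec P.toList k a x
  have hbx : ∀ i ∈ S ∪ P, b i = x i := by
    intro i hi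
    rcases Finset.mem_union.mp hi with hi | hi
    · exact hb i (Or.inl (hxa i hi).symm)
    · exact hb i (Or.inr (Finset.mem_toList.mpr hi))
  obtain ⟨t, ht⟩ := h x hx hxa
  have hex : ∃ t : DecisionTree n M, ∀ x ∈ X,
      (∀ i ∈ S ∪ P, x i = b i) → t.eval x = f x ∧ t.cost x ≤ q :=
    ⟨t, fun y hy hyb => ht y hy fun i hi => (hyb i hi).trans (hbx i hi)⟩
  have hk : k b = hex.choose := dif_pos hex
  have := hex.choose_spec x hx fun i hi => (hbx i hi).symm
  rw [he, hc, hk, Finset.length_toList]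
  exact ⟨this.1, Nat.add_le_add_right this.2 _⟩

/-- Any function is computed by querying every position. -/
theorem exists_trivial {n M : ℕ} (f : Input n M → Bool) :
    ∃ t : DecisionTree n M, ∀ x, t.eval x = f x ∧ t.cost x ≤ n := by
  classical
  by_cases hne : Nonempty (Input n M)
  · obtain ⟨a⟩ := hne
    obtain ⟨t, ht⟩ := exists_of_query Set.univ f ∅ Finset.univ a 0 fun b _ _ =>
      ⟨output (f b), fun x _ hx => by
        have : x = b := funext fun i => hx i (by simp)
        rw [this]
        exact ⟨rfl, le_rfl⟩⟩
    exact ⟨t, fun x => by simpa using ht x (Set.mem_univ _) (by simp)⟩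
  · exact ⟨output true, fun x => absurd ⟨x⟩ hne⟩

end DecisionTree

/-! ### Conflicting certificates and the algorithm on permutations -/

/-- A map that is injective on a finite set of positions extends to a permutation. -/
theorem exists_perm_extending {n : ℕ} (s : Finset (Fin n)) (h : Fin n → Fin n)
    (hs : Set.InjOn h s) : ∃ y : Equiv.Perm (Fin n), ∀ i ∈ s, y i = h i := by
  obtain ⟨g, hg⟩ := Finset.exists_equiv_extend_of_card_eq (t := (Finset.univ : Finset (Fin n)))
    (by simp) (Finset.subset_univ (s.image h)) hs
  exact ⟨g.trans (Equiv.subtypeUnivEquiv fun i => Finset.mem_univ i), hg⟩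

/-- Two certificates of opposite values conflict in a position or in a value. -/
theorem certificates_conflict {n : ℕ} {f : Equiv.Perm (Fin n) → Bool}
    {x z : Equiv.Perm (Fin n)} {Q P : Finset (Fin n)}
    (hQ : ∀ y : Equiv.Perm (Fin n), (∀ i ∈ Q, y i = x i) → f y = f x)
    (hP : ∀ y : Equiv.Perm (Fin n), (∀ i ∈ P, y i = z i) → f y = f z)
    (hne : f x ≠ f z) :
    (∃ i ∈ Q, i ∈ P ∧ x i ≠ z i) ∨ ∃ i ∈ Q, ∃ j ∈ P, i ≠ j ∧ x i = z j := by
  classical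
  by_contra hcon
  push Not at hcon
  obtain ⟨h1, h2⟩ := hcon
  obtain ⟨y, hy⟩ := exists_perm_extending (Q ∪ P) (fun i => if i ∈ Q then x i else z i) (by
    intro i hi j hj hij
    by_cases hiQ : i ∈ Q <;> by_cases hjQ : j ∈ Q
    · simp only [hiQ, hjQ, if_true] at hij
      exact x.injective hij
    · simp only [hiQ, hjQ, if_true, if_false] at hij
      by_contra hne
      exact h2 i hiQ j (by simpa [hjQ] using hj) hne hij
    · simp only [hiQ, hjQ, if_true, if_false] at hij
      by_contra hne
      exact h2 j hjQ i (by simpa [hiQ] using hi) (Ne.symm hne) hij.symm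
    · simp only [hiQ, hjQ, if_false] at hij
      exact z.injective hij)
  have e1 := hQ y fun i hi => by
    rw [hy i (Finset.mem_union_left _ hi), if_pos hi]
  have e2 := hP y fun i hi => by
    rw [hy i (Finset.mem_union_right _ hi)]
    split_ifs with h
    · exact h1 i h hi
    · rfl
  exact hne (e1.symm.trans e2)

namespace QueryWeights

variable {n W : ℕ} {f : Equiv.Perm (Fin n) → Bool}

/-- The algorithm that repeatedly queries a certificate whose values are new. The counter `r b`
is the number of certificates for `b` queried so far, and `V` is the set of their values. -/
theorem exists_tree_of_state
    (H : QueryWeights (fun π : Equiv.Perm (Fin n) => (π : Input n n)) f W)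
    {C : ℕ} (hC : C = 3 * W * (2 * W))
    (hn : (4 * C + 1) * C * (2 + (6 * W + 1) * (3 * W)) ≤ n) (R : ℕ) :
    ∀ (S V : Finset (Fin n)) (a : Equiv.Perm (Fin n)) (r : Bool → ℕ),
      r true + r false + R = 4 * C + 1 → S.card ≤ (r true + r false) * C →
      V.card ≤ (r true + r false) * C →
      (∀ (x : Equiv.Perm (Fin n)) (Q : Finset (Fin n)), (∀ i ∈ S, x i = a i) → Q.card ≤ C →
        (∀ y : Equiv.Perm (Fin n), (∀ i ∈ Q, y i = x i) → f y = f x) →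
        r (!f x) ≤ (Q ∩ S).card + (Q.image x ∩ V).card) →
      ∃ t : DecisionTree n n, ∀ x : Equiv.Perm (Fin n), (∀ i ∈ S, x i = a i) →
        t.eval x = f x ∧ t.cost x ≤ R * C := by
  classical
  induction R with
  | zero =>
    intro S V a r hr _ _ hinv
    -- A true certificate has at most `C` positions and `C` values, so at most `2 * C` rounds
    -- opposed it. With `4 * C + 1` rounds in all, the majority is right.
    have hbound : ∀ x : Equiv.Perm (Fin n), (∀ i ∈ S, x i = a i) → r (!f x) ≤ 2 * C := by
      intro x hx
      obtain ⟨Q, hQ, hQf⟩ := H.exists_certificate_all x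
      have hQC : Q.card ≤ C := hQ.trans (by rw [hC]; nlinarith [Nat.zero_le (W * W)])
      have h1 := hinv x Q hx hQC hQf
      have h2 : (Q ∩ S).card ≤ Q.card := Finset.card_le_card Finset.inter_subset_left
      have h3 : (Q.image x ∩ V).card ≤ Q.card :=
        (Finset.card_le_card Finset.inter_subset_left).trans Finset.card_image_le
      omega
    refine ⟨.output (decide (2 * C < r true)), fun x hx => ⟨?_, Nat.zero_le _⟩⟩
    have h := hbound x hx
    simp only [DecisionTree.eval]
    cases hfx : f x
    · rw [hfx] at h
      simpa using h
    · rw [hfx] at h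
      simp only [Bool.not_true] at h
      simp only [decide_eq_true_eq]
      omega
  | succ R ih =>
    intro S V a r hr hS hV hinv
    have hK : (r true + r false) * C ≤ (4 * C + 1) * C := Nat.mul_le_mul_right _ (by omega)
    obtain ⟨z, P, hzS, hzV, hPc, hP⟩ := H.exists_certificate_avoiding a S V (by
      calc S.card + V.card * (1 + (6 * W + 1) * (3 * W))
          ≤ (4 * C + 1) * C + (4 * C + 1) * C * (1 + (6 * W + 1) * (3 * W)) :=
            Nat.add_le_add (hS.trans hK) (Nat.mul_le_mul_right _ (hV.trans hK))
        _ = (4 * C + 1) * C * (2 + (6 * W + 1) * (3 * W)) := by ring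
        _ ≤ n := hn)
    rw [← hC] at hPc
    -- An extension of `f` to all strings, the form that `DecisionTree.exists_of_query` takes.
    let F : Input n n → Bool := fun y => decide (∃ π : Equiv.Perm (Fin n), ⇑π = y ∧ f π = true)
    have hF : ∀ π : Equiv.Perm (Fin n), F π = f π := by
      intro π
      simp only [F]
      rw [Bool.eq_iff_iff, decide_eq_true_eq]
      constructor
      · rintro ⟨σ, h1, h2⟩
        rwa [← DFunLike.coe_injective h1]
      · exact fun h => ⟨π, rfl, h⟩
    have hr' : ∀ b, (r + Pi.single b 1 : Bool → ℕ) true + (r + Pi.single b 1 : Bool → ℕ) false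
        = r true + r false + 1 := by
      intro b
      cases b <;> simp <;> omega
    obtain ⟨t, ht⟩ := DecisionTree.exists_of_query
      (Set.range fun π : Equiv.Perm (Fin n) => (π : Input n n)) F S P a (R * C) (by
      rintro _ ⟨b, rfl⟩ hb
      obtain ⟨t, ht⟩ := ih (S ∪ P) (V ∪ P.image z) b (r + Pi.single (f z) 1)
        (by rw [hr']; omega)
        (by
          rw [hr', Nat.add_mul, Nat.one_mul]
          exact (Finset.card_union_le _ _).trans (Nat.add_le_add hS hPc))
        (by
          rw [hr', Nat.add_mul, Nat.one_mul]
          exact (Finset.card_union_le _ _).trans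
            (Nat.add_le_add hV (Finset.card_image_le.trans hPc)))
        (by
          intro x Q hx hQ hQf
          have hxa : ∀ i ∈ S, x i = a i := fun i hi =>
            (hx i (Finset.mem_union_left _ hi)).trans (hb i hi)
          have h0 := hinv x Q hxa hQ hQf
          have m1 : Q ∩ S ⊆ Q ∩ (S ∪ P) :=
            Finset.inter_subset_inter_left Finset.subset_union_left
          have m2 : Q.image x ∩ V ⊆ Q.image x ∩ (V ∪ P.image z) :=
            Finset.inter_subset_inter_left Finset.subset_union_left
          by_cases hfx : f x = f z
          · have hne : (!f x) ≠ f z := by rw [hfx]; simp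
            rw [Pi.add_apply, Pi.single_eq_of_ne hne, Nat.add_zero]
            exact h0.trans (Nat.add_le_add (Finset.card_le_card m1) (Finset.card_le_card m2))
          · have heq : (!f x) = f z := by
              revert hfx; cases f x <;> cases f z <;> simp
            rw [heq] at h0
            rw [Pi.add_apply, heq, Pi.single_eq_same]
            by_cases hpos : ∃ i ∈ Q, i ∈ P ∧ i ∉ S
            · obtain ⟨i, hiQ, hiP, hiS⟩ := hpos
              have : (Q ∩ S).card < (Q ∩ (S ∪ P)).card := by
                refine Finset.card_lt_card ((Finset.ssubset_iff_of_subset m1).mpr ⟨i, ?_, ?_⟩)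
                · simp [hiQ, hiP]
                · simp [hiS]
              have := Finset.card_le_card m2
              omega
            · push Not at hpos
              rcases certificates_conflict hQf hP hfx with
                ⟨i, hiQ, hiP, hne⟩ | ⟨i, hiQ, j, hjP, hij, h⟩
              · have hiS := hpos i hiQ hiP
                exact absurd ((hxa i hiS).trans (hzS i hiS).symm) hne
              · have hxV : x i ∉ V := by
                  intro hxV
                  have hjS := hzV j hjP (h ▸ hxV)
                  have : x j = x i := (hxa j hjS).trans ((hzS j hjS).symm.trans h.symm)
                  exact hij (x.injective this).symm
                have : (Q.image x ∩ V).card < (Q.image x ∩ (V ∪ P.image z)).card := by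
                  refine Finset.card_lt_card
                    ((Finset.ssubset_iff_of_subset m2).mpr ⟨x i, ?_, ?_⟩)
                  · rw [Finset.mem_inter, Finset.mem_union]
                    exact ⟨Finset.mem_image_of_mem _ hiQ,
                      Or.inr (h ▸ Finset.mem_image_of_mem _ hjP)⟩
                  · simp [hxV]
                have := Finset.card_le_card m1
                omega)
      refine ⟨t, ?_⟩
      rintro _ ⟨x, rfl⟩ hx
      simp only [hF]
      exact ht x hx)
    refine ⟨t, fun x hx => ?_⟩
    obtain ⟨h1, h2⟩ := ht x ⟨x, rfl⟩ hx
    rw [hF] at h1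
    refine ⟨h1, h2.trans ?_⟩
    rw [Nat.add_mul, Nat.one_mul]
    exact Nat.add_le_add_left hPc _

/-- A function on permutations with query weights of mass `W` has deterministic query
complexity `O(W ^ 6)`. -/
theorem exists_tree_perm
    (H : QueryWeights (fun π : Equiv.Perm (Fin n) => (π : Input n n)) f W)
    : ∃ t : DecisionTree n n, ∀ x : Equiv.Perm (Fin n),
    t.eval x = f x ∧ t.cost x ≤ 3450 * W ^ 6 := by
  classical
  by_cases hconst : ∀ x y, f x = f y
  · exact ⟨.output (f 1), fun x => ⟨hconst 1 x, Nat.zero_le _⟩⟩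
  push Not at hconst
  obtain ⟨x₀, y₀, hxy⟩ := hconst
  have hW : 1 ≤ W := H.pos_of_ne hxy
  obtain ⟨C, hC⟩ : ∃ C, C = 3 * W * (2 * W) := ⟨_, rfl⟩
  have hW2 : 1 ≤ W ^ 2 := Nat.one_le_pow _ _ hW
  have hWW : W ≤ W ^ 2 := by nlinarith
  have hC' : C = 6 * W ^ 2 := by rw [hC]; ring
  have hCC : (4 * C + 1) * C ≤ 150 * W ^ 4 := by
    calc (4 * C + 1) * C ≤ (25 * W ^ 2) * (6 * W ^ 2) := by
          rw [hC']; exact Nat.mul_le_mul_right _ (by omega)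
      _ = 150 * W ^ 4 := by ring
  -- The left side is the room needed for hiding in every round. It is `O(W ^ 6)`, so when `n` falls
  -- short, reading the whole input is affordable.
  by_cases hn : (4 * C + 1) * C * (2 + (6 * W + 1) * (3 * W)) ≤ n
  · obtain ⟨t, ht⟩ := H.exists_tree_of_state hC hn (4 * C + 1) ∅ ∅ 1 0 (by simp) (by simp)
      (by simp) (by simp)
    refine ⟨t, fun x => ⟨(ht x (by simp)).1, (ht x (by simp)).2.trans (hCC.trans ?_)⟩⟩
    calc 150 * W ^ 4 ≤ 3450 * W ^ 4 := by omega
      _ ≤ 3450 * W ^ 6 := Nat.mul_le_mul_left _ (Nat.pow_le_pow_right hW (by norm_num))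
  · rw [not_le] at hn
    have hn' : n ≤ 3450 * W ^ 6 := by
      calc n ≤ (4 * C + 1) * C * (2 + (6 * W + 1) * (3 * W)) := hn.le
        _ ≤ (150 * W ^ 4) * (23 * W ^ 2) := Nat.mul_le_mul hCC (by nlinarith)
        _ = 3450 * W ^ 6 := by ring
    let F : Input n n → Bool := fun y => decide (∃ π : Equiv.Perm (Fin n), ⇑π = y ∧ f π = true)
    obtain ⟨t, ht⟩ := DecisionTree.exists_trivial F
    refine ⟨t, fun x => ⟨(ht x).1.trans ?_, (ht x).2.trans hn'⟩⟩
    rw [Bool.eq_iff_iff, decide_eq_true_eq]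
    constructor
    · rintro ⟨σ, h1, h2⟩
      rwa [← DFunLike.coe_injective h1]
    · exact fun h => ⟨x, rfl, h⟩

end QueryWeights

/-! ### From permutations to inputs of one type -/

/-- Inputs of the same type differ by a permutation of the coordinates. -/
theorem exists_perm_of_inputType_eq {n M : ℕ} {x y : Input n M}
    (h : inputType x = inputType y) : ∃ π : Equiv.Perm (Fin n), x = y ∘ π := by
  classical
  have hcard : ∀ v, Nonempty ({i // x i = v} ≃ {i // y i = v}) := by
    intro v
    have hv := congrArg (Multiset.count v) h
    simp only [inputType, Multiset.count_map] at hv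
    refine ⟨Fintype.equivOfCardEq ?_⟩
    rw [Fintype.card_subtype, Fintype.card_subtype]
    simpa [Finset.card, Finset.filter, eq_comm] using hv
  refine ⟨Equiv.ofFiberEquiv fun v => (hcard v).some, ?_⟩
  funext i
  exact (Equiv.ofFiberEquiv_map _ i).symm

/-- The permutation in `exists_perm_of_inputType_eq` may be prescribed on any set of positions
where the prescription is correct. -/
theorem exists_perm_extending_of_inputType_eq {n M : ℕ} {x y : Input n M}
    (h : inputType x = inputType y) (a : Equiv.Perm (Fin n)) (S : Finset (Fin n))
    (hS : ∀ i ∈ S, x i = y (a i)) :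
    ∃ π : Equiv.Perm (Fin n), x = y ∘ π ∧ ∀ i ∈ S, π i = a i := by
  classical
  induction S using Finset.induction_on with
  | empty =>
    obtain ⟨π, hπ⟩ := exists_perm_of_inputType_eq h
    exact ⟨π, hπ, by simp⟩
  | insert i S hi ih =>
    obtain ⟨π, hπ, hπS⟩ := ih fun j hj => hS j (Finset.mem_insert_of_mem hj)
    have hy : y (π i) = y (a i) := by
      rw [← hS i (Finset.mem_insert_self _ _), hπ]; rfl
    -- The two swapped labels carry the same symbol under `y`, so `y ∘ π` is unchanged.
    refine ⟨π.trans (Equiv.swap (π i) (a i)), ?_, ?_⟩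
    · funext j
      rw [hπ]
      simp only [Function.comp_apply, Equiv.trans_apply]
      rw [Equiv.swap_apply_def]
      split_ifs with h1 h2
      · rw [h1, hy]
      · rw [h2, hy]
      · rfl
    · intro j hj
      rcases Finset.mem_insert.mp hj with rfl | hj
      · simp
      · have hji : j ≠ i := fun h => hi (h ▸ hj)
        rw [Equiv.trans_apply, Equiv.swap_apply_of_ne_of_ne, hπS j hj]
        · exact fun h => hji (π.injective h)
        · rw [hπS j hj]
          exact fun h => hji (a.injective h)

/-- A decision tree for permutations can be run on an input of given type, by choosing labels for
equal entries on the fly. -/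
theorem DecisionTree.exists_simulation {n M : ℕ} (x₀ : Input n M) (t : DecisionTree n n) :
    ∀ (S : Finset (Fin n)) (a : Equiv.Perm (Fin n)), ∃ t' : DecisionTree n M, ∀ x : Input n M,
      inputType x = inputType x₀ → (∀ i ∈ S, x i = x₀ (a i)) →
      ∃ π : Equiv.Perm (Fin n), x = x₀ ∘ π ∧ (∀ i ∈ S, π i = a i) ∧
        t'.eval x = t.eval π ∧ t'.cost x = t.cost π := by
  classical
  induction t with
  | output b =>
    intro S a
    refine ⟨.output b, fun x hx hxS => ?_⟩
    obtain ⟨π, h1, h2⟩ := exists_perm_extending_of_inputType_eq hx a S hxS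
    exact ⟨π, h1, h2, rfl, rfl⟩
  | query i next ih =>
    intro S a
    have hsub : ∀ v : Fin M, ∃ t' : DecisionTree n M, ∀ x : Input n M,
        inputType x = inputType x₀ → (∀ i ∈ S, x i = x₀ (a i)) → x i = v →
        ∃ π : Equiv.Perm (Fin n), x = x₀ ∘ π ∧ (∀ i ∈ S, π i = a i) ∧
          t'.eval x = (next (π i)).eval π ∧ t'.cost x = (next (π i)).cost π := by
      intro v
      -- An answer `v` that no labelling compatible with `a` on `S` produces cannot occur on this
      -- type, so its leaf is arbitrary.
      by_cases hv : ∃ b : Equiv.Perm (Fin n), (∀ j ∈ S, b j = a j) ∧ x₀ (b i) = v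
      · obtain ⟨b, hbS, hbi⟩ := hv
        obtain ⟨t', ht'⟩ := ih (b i) (insert i S) b
        refine ⟨t', fun x hx hxS hxi => ?_⟩
        obtain ⟨π, h1, h2, h3, h4⟩ := ht' x hx (by
          intro j hj
          rcases Finset.mem_insert.mp hj with rfl | hj
          · rw [hxi, hbi]
          · rw [hxS j hj, hbS j hj])
        have hπi : π i = b i := h2 i (Finset.mem_insert_self _ _)
        refine ⟨π, h1, fun j hj => ?_, by rw [h3, hπi], by rw [h4, hπi]⟩
        rw [h2 j (Finset.mem_insert_of_mem hj), hbS j hj]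
      · refine ⟨.output true, fun x hx hxS hxi => ?_⟩
        obtain ⟨π, h1, h2⟩ := exists_perm_extending_of_inputType_eq hx a S hxS
        refine absurd ⟨π, h2, ?_⟩ hv
        rw [← hxi, h1]; rfl
    choose t' ht' using hsub
    refine ⟨.query i t', fun x hx hxS => ?_⟩
    obtain ⟨π, h1, h2, h3, h4⟩ := ht' (x i) x hx hxS rfl
    exact ⟨π, h1, h2, by simpa [eval] using h3, by simpa [cost] using h4⟩

/-- A function on inputs of one type with query weights of mass `W` has deterministic query
complexity `O(W ^ 6)`. -/
theorem QueryWeights.detComputable {n M W : ℕ} {T : Set (Input n M)} (hT : IsTypePromise T)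
    {f : T → Bool} (H : QueryWeights (Subtype.val : T → Input n M) f W) :
    DetComputable f (3450 * W ^ 6) := by
  obtain ⟨x₀, rfl⟩ := hT
  have hmem : ∀ π : Equiv.Perm (Fin n), inputType (x₀ ∘ π) = inputType x₀ := by
    intro π
    simp only [inputType]
    rw [← Multiset.map_map]
    congr 1
    simp
  let r : Equiv.Perm (Fin n) → {x | inputType x = inputType x₀} := fun π => ⟨x₀ ∘ π, hmem π⟩
  obtain ⟨t, ht⟩ := (H.comap x₀ (fun π : Equiv.Perm (Fin n) => (π : Input n n)) r
    fun _ => rfl).exists_tree_perm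
  obtain ⟨t', ht'⟩ := DecisionTree.exists_simulation x₀ t ∅ 1
  refine ⟨t', fun x => ?_⟩
  obtain ⟨π, h1, -, h3, h4⟩ := ht' x x.2 (by simp)
  have hx : r π = x := Subtype.ext h1.symm
  rw [h3, h4, (ht π).1, Function.comp_apply, hx]
  exact ⟨rfl, (ht π).2⟩

/-! ### Query weights from randomized algorithms -/

namespace DecisionTree

/-- The output on `x` when the algorithm is stopped after `q` queries. -/
def evalWithin {n M : ℕ} : ℕ → DecisionTree n M → Input n M → Bool
  | _, output b, _ => b
  | 0, query _ _, _ => false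
  | q + 1, query i next, x => (next (x i)).evalWithin q x

/-- The positions among the first `q` queries on `x`. -/
def visited {n M : ℕ} : ℕ → DecisionTree n M → Input n M → Finset (Fin n)
  | _, output _, _ => ∅
  | 0, query _ _, _ => ∅
  | q + 1, query i next, x => insert i ((next (x i)).visited q x)

theorem evalWithin_eq_eval {n M : ℕ} (q : ℕ) (t : DecisionTree n M) (x : Input n M)
    (h : t.cost x ≤ q) : t.evalWithin q x = t.eval x := by
  induction q generalizing t with
  | zero =>
    cases t with
    | output b => rfl
    | query i next => simp [cost] at h
  | succ q ih =>
    cases t with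
    | output b => rfl
    | query i next =>
      simp only [cost] at h
      exact ih _ (by omega)

theorem card_visited_le {n M : ℕ} (q : ℕ) (t : DecisionTree n M) (x : Input n M) :
    (t.visited q x).card ≤ q := by
  induction q generalizing t with
  | zero => cases t <;> simp [visited]
  | succ q ih =>
    cases t with
    | output b => simp [visited]
    | query i next =>
      exact (Finset.card_insert_le _ _).trans (Nat.add_le_add_right (ih _) 1)

theorem evalWithin_congr {n M : ℕ} (q : ℕ) (t : DecisionTree n M) {x y : Input n M}
    (h : ∀ i ∈ t.visited q x, x i = y i) : t.evalWithin q x = t.evalWithin q y := by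
  induction q generalizing t with
  | zero => cases t <;> rfl
  | succ q ih =>
    cases t with
    | output b => rfl
    | query i next =>
      simp only [visited, Finset.mem_insert, forall_eq_or_imp] at h
      simp only [evalWithin]
      rw [← h.1]
      exact ih _ h.2

end DecisionTree

/-- A randomized algorithm with `q` queries gives query weights of mass `12 * q`: the weight of a
position is twelve times the probability that it is queried. -/
theorem RandComputable.queryWeights {n M : ℕ} {X : Set (Input n M)} {f : X → Bool} {q : ℕ}
    (h : RandComputable f q) :
    Nonempty (QueryWeights (Subtype.val : X → Input n M) f (12 * q)) := by
  classical
  obtain ⟨μ, hμ⟩ := h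
  have hle : ∀ s, μ.toOuterMeasure s ≤ 1 := by
    intro s
    rw [← (μ.toOuterMeasure_apply_eq_one_iff Set.univ).mpr (Set.subset_univ _)]
    exact MeasureTheory.measure_mono (Set.subset_univ s)
  have hfin : ∀ s, μ.toOuterMeasure s ≠ ∞ := fun s => ne_top_of_le_ne_top ENNReal.one_ne_top (hle s)
  let P : Set (DecisionTree n M) → ℝ := fun s => (μ.toOuterMeasure s).toReal
  have hP0 : ∀ s, 0 ≤ P s := fun s => ENNReal.toReal_nonneg
  -- Query counts are bounded only on the promise. Stopping after `q` queries bounds the mass on all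
  -- strings and changes no output on the promise.
  let acc : Input n M → Set (DecisionTree n M) := fun x => {t | t.evalWithin q x = true}
  let vis : Input n M → Fin n → Set (DecisionTree n M) := fun x i => {t | i ∈ t.visited q x}
  have hunion : ∀ (s t : Set (DecisionTree n M)) (D : Finset (Fin n)) (x : Input n M),
      s ⊆ t ∪ ⋃ i ∈ D, vis x i → P s ≤ P t + ∑ i ∈ D, P (vis x i) := by
    intro s t D x hst
    have h1 : μ.toOuterMeasure s ≤ μ.toOuterMeasure t + ∑ i ∈ D, μ.toOuterMeasure (vis x i) :=
      (MeasureTheory.measure_mono hst).trans ((MeasureTheory.measure_union_le _ _).trans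
        (add_le_add_right (MeasureTheory.measure_biUnion_finset_le _ _) _))
    have h2 : ∑ i ∈ D, μ.toOuterMeasure (vis x i) ≠ ∞ :=
      ENNReal.sum_ne_top.mpr fun i _ => hfin _
    have h3 := ENNReal.toReal_mono (ENNReal.add_ne_top.mpr ⟨hfin t, h2⟩) h1
    rwa [ENNReal.toReal_add (hfin t) h2, ENNReal.toReal_sum fun i _ => hfin _] at h3
  have hcongr : ∀ x y (t : DecisionTree n M), t ∉ ⋃ i ∈ diffSet x y, vis x i →
      t.evalWithin q x = t.evalWithin q y := by
    intro x y t ht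
    refine t.evalWithin_congr q fun i hi => ?_
    by_contra hne
    refine ht ?_
    simp only [Set.mem_iUnion]
    exact ⟨i, mem_diffSet.mpr hne, hi⟩
  have hone : P Set.univ = 1 := by
    simp only [P]
    rw [(μ.toOuterMeasure_apply_eq_one_iff Set.univ).mpr (Set.subset_univ _)]
    rfl
  have herr : ∀ x : X, P {t | t.eval x ≠ f x} ≤ 1 / 3 := by
    intro x
    have := ENNReal.toReal_mono (by simp) (hμ x).1
    simpa [P] using this
  have hwithin : ∀ (x : X) t, t ∈ μ.support → t.evalWithin q x = t.eval x := fun x t ht =>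
    t.evalWithin_eq_eval q x ((hμ x).2 t ht)
  have htrue : ∀ x : X, f x = true → 2 / 3 ≤ P (acc x) := by
    intro x hx
    have h1 : μ.toOuterMeasure Set.univ ≤
        μ.toOuterMeasure (acc x) + μ.toOuterMeasure {t | t.eval x ≠ f x} := by
      -- The inclusion is needed only on the support of `μ`, which is where the cost bound holds.
      refine (μ.toOuterMeasure_mono ?_).trans (MeasureTheory.measure_union_le _ _)
      intro t ht
      by_cases he : t.eval x = f x
      · left
        change t.evalWithin q x = true
        rw [hwithin x t ht.2, he, hx]
      · right; exact he
    have h2 := ENNReal.toReal_mono (ENNReal.add_ne_top.mpr ⟨hfin _, hfin _⟩) h1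
    rw [ENNReal.toReal_add (hfin _) (hfin _)] at h2
    have h3 := herr x
    change P Set.univ ≤ P (acc x) + P _ at h2
    linarith
  have hfalse : ∀ x : X, f x = false → P (acc x) ≤ 1 / 3 := by
    intro x hx
    refine le_trans (ENNReal.toReal_mono (hfin _) (μ.toOuterMeasure_mono ?_)) (herr x)
    intro t ht
    have h1 : t.evalWithin q x = true := ht.1
    rw [hwithin x t ht.2] at h1
    change t.eval x ≠ f x
    rw [h1, hx]
    simp
  have hsum : ∀ x, ∑ i, P (vis x i) ≤ q := by
    intro x
    have h1 : ∑ i, μ.toOuterMeasure (vis x i) ≤ q := by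
      calc ∑ i, μ.toOuterMeasure (vis x i) = ∑ i, ∑' t, (vis x i).indicator μ t := by
            simp only [PMF.toOuterMeasure_apply]
        _ = ∑' t, ∑ i, (vis x i).indicator μ t :=
            (Summable.tsum_finsetSum fun i _ => ENNReal.summable).symm
        _ ≤ ∑' t, q * μ t := by
            refine ENNReal.tsum_le_tsum fun t => ?_
            have : ∑ i, (vis x i).indicator μ t = (t.visited q x).card * μ t := by
              simp only [Set.indicator_apply, vis, Set.mem_ofPred_eq]
              rw [← Finset.sum_filter]
              simp
            rw [this]
            gcongr
            exact t.card_visited_le q x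
        _ = q := by rw [ENNReal.tsum_mul_left, μ.tsum_coe, mul_one]
    have h2 := ENNReal.toReal_mono (ENNReal.natCast_ne_top q) h1
    rwa [ENNReal.toReal_sum fun i _ => hfin _, ENNReal.toReal_natCast] at h2
  exact ⟨{
    p := fun x => P (acc x)
    w := fun x i => 12 * P (vis x i)
    nonneg := fun x i => mul_nonneg (by norm_num) (hP0 _)
    sum_le := fun x => by
      rw [← Finset.mul_sum]
      push_cast
      linarith [hsum x]
    stable := fun x y hxy => by
      rw [← Finset.mul_sum] at hxy
      have h1 := hunion (acc x) (acc y) (diffSet x y) x (by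
        intro t ht
        by_cases hmem : t ∈ ⋃ i ∈ diffSet x y, vis x i
        · exact Or.inr hmem
        · exact Or.inl ((hcongr x y t hmem).symm.trans ht))
      have h2 := hunion (acc y) (acc x) (diffSet x y) x (by
        intro t ht
        by_cases hmem : t ∈ ⋃ i ∈ diffSet x y, vis x i
        · exact Or.inr hmem
        · exact Or.inl ((hcongr x y t hmem).trans ht))
      rw [abs_lt]
      constructor <;> linarith
    separated := fun x y hxy => by
      rw [le_abs]
      cases hx : f x <;> cases hy : f y
      · simp [hx, hy] at hxy
      · right; linarith [hfalse x hx, htrue y hy]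
      · left; linarith [htrue x hx, hfalse y hy]
      · simp [hx, hy] at hxy }⟩

/-! ### Query weights from quantum algorithms -/

/-- The Euclidean norm of a vector of amplitudes. -/
noncomputable def ampNorm {ι : Type*} [Fintype ι] (ψ : ι → ℂ) : ℝ := ‖WithLp.toLp 2 ψ‖

section Norm

variable {ι : Type*} [Fintype ι]

theorem ampNorm_nonneg (ψ : ι → ℂ) : 0 ≤ ampNorm ψ := norm_nonneg _

theorem ampNorm_sq (ψ : ι → ℂ) : ampNorm ψ ^ 2 = ∑ s, ‖ψ s‖ ^ 2 := by
  simp [ampNorm, EuclideanSpace.norm_sq_eq]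

theorem ampNorm_sub_le (ψ φ χ : ι → ℂ) :
    ampNorm (ψ - χ) ≤ ampNorm (ψ - φ) + ampNorm (φ - χ) := by
  simp only [ampNorm, WithLp.toLp_sub]
  exact norm_sub_le_norm_sub_add_norm_sub _ _ _

theorem ampNorm_mulVec_unitary [DecidableEq ι] (U : Matrix.unitaryGroup ι ℂ) (ψ : ι → ℂ) :
    ampNorm ((U : Matrix ι ι ℂ).mulVec ψ) = ampNorm ψ := by
  have hsq : ∀ φ : ι → ℂ, ((ampNorm φ ^ 2 : ℝ) : ℂ) = star φ ⬝ᵥ φ := by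
    intro φ
    rw [ampNorm_sq]
    simp only [dotProduct, Pi.star_apply, RCLike.star_def, Complex.conj_mul']
    push_cast
    rfl
  have h : ampNorm ((U : Matrix ι ι ℂ).mulVec ψ) ^ 2 = ampNorm ψ ^ 2 := by
    have : ((ampNorm ((U : Matrix ι ι ℂ).mulVec ψ) ^ 2 : ℝ) : ℂ) = (ampNorm ψ ^ 2 : ℝ) := by
      rw [hsq, hsq, Matrix.star_mulVec, ← Matrix.dotProduct_mulVec, Matrix.mulVec_mulVec,
        ← Matrix.star_eq_conjTranspose, Matrix.UnitaryGroup.star_mul_self, Matrix.one_mulVec]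
    exact_mod_cast this
  exact (sq_eq_sq₀ (ampNorm_nonneg _) (ampNorm_nonneg _)).mp h

/-- Probabilities of an event under two states differ by at most twice their distance. -/
theorem abs_sum_sq_sub_le (ψ φ : ι → ℂ) (hψ : ampNorm ψ = 1) (hφ : ampNorm φ = 1)
    (s : ι → Prop) [DecidablePred s] :
    |(∑ i, if s i then ‖ψ i‖ ^ 2 else 0) - ∑ i, if s i then ‖φ i‖ ^ 2 else 0|
      ≤ 2 * ampNorm (ψ - φ) := by
  have h1 : |(∑ i, if s i then ‖ψ i‖ ^ 2 else 0) - ∑ i, if s i then ‖φ i‖ ^ 2 else 0|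
      ≤ ∑ i, ‖(ψ - φ) i‖ * (‖ψ i‖ + ‖φ i‖) := by
    rw [← Finset.sum_sub_distrib]
    refine (Finset.abs_sum_le_sum_abs _ _).trans (Finset.sum_le_sum fun i _ => ?_)
    have hle : |‖ψ i‖ ^ 2 - ‖φ i‖ ^ 2| ≤ ‖(ψ - φ) i‖ * (‖ψ i‖ + ‖φ i‖) := by
      rw [sq_sub_sq, abs_mul, abs_of_nonneg (by positivity : 0 ≤ ‖ψ i‖ + ‖φ i‖), mul_comm]
      gcongr
      exact abs_norm_sub_norm_le _ _
    split_ifs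
    · exact hle
    · simp only [sub_zero, abs_zero]
      positivity
  have hcs : ∀ χ : ι → ℂ, ampNorm χ = 1 →
      ∑ i, ‖(ψ - φ) i‖ * ‖χ i‖ ≤ ampNorm (ψ - φ) := by
    intro χ hχ
    have := Finset.sum_mul_sq_le_sq_mul_sq Finset.univ (fun i => ‖(ψ - φ) i‖) fun i => ‖χ i‖
    rw [← ampNorm_sq, ← ampNorm_sq, hχ, one_pow, mul_one] at this
    exact abs_le_of_sq_le_sq' this (ampNorm_nonneg _) |>.2
  simp only [mul_add, Finset.sum_add_distrib] at h1
  linarith [hcs ψ hψ, hcs φ hφ]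

end Norm

section Oracle

variable {n M d : ℕ}

theorem sum_sub_right {M : ℕ} (c : Fin M) (g : Fin M → ℝ) : ∑ b, g (b - c) = ∑ b, g b := by
  cases M with
  | zero => exact c.elim0
  | succ M => exact Equiv.sum_comp (Equiv.subRight c) g

/-- The probability that the query register of `ψ` holds the position `i`. -/
noncomputable def queryMass (ψ : QBasis n M d → ℂ) (i : Fin n) : ℝ :=
  ∑ b : Fin M, ∑ w : Fin d, ‖ψ (some i, b, w)‖ ^ 2

theorem queryMass_nonneg (ψ : QBasis n M d → ℂ) (i : Fin n) : 0 ≤ queryMass ψ i :=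
  Finset.sum_nonneg fun _ _ => Finset.sum_nonneg fun _ _ => sq_nonneg _

theorem ampNorm_sq_eq_add (ψ : QBasis n M d → ℂ) : ampNorm ψ ^ 2 =
    (∑ b : Fin M, ∑ w : Fin d, ‖ψ (none, b, w)‖ ^ 2) + ∑ i, queryMass ψ i := by
  rw [ampNorm_sq]
  simp only [Fintype.sum_prod_type, Fintype.sum_option, queryMass]

theorem sum_queryMass_le (ψ : QBasis n M d → ℂ) : ∑ i, queryMass ψ i ≤ ampNorm ψ ^ 2 := by
  rw [ampNorm_sq_eq_add]
  exact le_add_of_nonneg_left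
    (Finset.sum_nonneg fun _ _ => Finset.sum_nonneg fun _ _ => sq_nonneg _)

theorem ampNorm_oracle (x : Input n M) (ψ : QBasis n M d → ℂ) :
    ampNorm (oracle x ψ) = ampNorm ψ := by
  refine (sq_eq_sq₀ (ampNorm_nonneg _) (ampNorm_nonneg _)).mp ?_
  rw [ampNorm_sq_eq_add, ampNorm_sq_eq_add]
  congr 1
  refine Finset.sum_congr rfl fun i _ => ?_
  exact sum_sub_right (x i) fun b => ∑ w, ‖ψ (some i, b, w)‖ ^ 2

theorem oracle_sub (x : Input n M) (ψ φ : QBasis n M d → ℂ) :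
    oracle x ψ - oracle x φ = oracle x (ψ - φ) := by
  funext ⟨o, b, w⟩
  cases o <;> rfl

theorem ampNorm_oracle_sub_oracle_le (x y : Input n M) (ψ : QBasis n M d → ℂ) :
    ampNorm (oracle x ψ - oracle y ψ) ≤ 2 * √(∑ i ∈ diffSet x y, queryMass ψ i) := by
  have hnn : 0 ≤ ∑ i ∈ diffSet x y, queryMass ψ i :=
    Finset.sum_nonneg fun i _ => queryMass_nonneg ψ i
  refine abs_le_of_sq_le_sq' ?_ (by positivity) |>.2
  rw [mul_pow, Real.sq_sqrt hnn, ampNorm_sq_eq_add]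
  have h0 : ∑ b : Fin M, ∑ w : Fin d, ‖(oracle x ψ - oracle y ψ) (none, b, w)‖ ^ 2 = 0 := by
    simp [oracle]
  have h1 : ∀ i, i ∉ diffSet x y → queryMass (oracle x ψ - oracle y ψ) i = 0 := by
    intro i hi
    rw [mem_diffSet, not_not] at hi
    simp [queryMass, oracle, hi]
  have h2 : ∀ i, queryMass (oracle x ψ - oracle y ψ) i ≤ 4 * queryMass ψ i := by
    intro i
    have e : ∀ z : Input n M, ∑ b : Fin M, ∑ w : Fin d, ‖ψ (some i, b - z i, w)‖ ^ 2
        = queryMass ψ i := fun z => sum_sub_right (z i) fun b => ∑ w, ‖ψ (some i, b, w)‖ ^ 2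
    calc queryMass (oracle x ψ - oracle y ψ) i
        ≤ ∑ b : Fin M, ∑ w : Fin d, (2 * ‖ψ (some i, b - x i, w)‖ ^ 2
            + 2 * ‖ψ (some i, b - y i, w)‖ ^ 2) := by
          refine Finset.sum_le_sum fun b _ => Finset.sum_le_sum fun w _ => ?_
          have h := norm_sub_le (ψ (some i, b - x i, w)) (ψ (some i, b - y i, w))
          have h' := norm_nonneg (ψ (some i, b - x i, w) - ψ (some i, b - y i, w))
          change ‖ψ (some i, b - x i, w) - ψ (some i, b - y i, w)‖ ^ 2 ≤ _
          nlinarith [sq_nonneg (‖ψ (some i, b - x i, w)‖ - ‖ψ (some i, b - y i, w)‖)]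
      _ = 4 * queryMass ψ i := by
          simp only [Finset.sum_add_distrib, ← Finset.mul_sum, e]
          ring
  rw [h0, zero_add, Finset.mul_sum,
    ← Finset.sum_subset (Finset.subset_univ (diffSet x y)) fun i _ hi => h1 i hi]
  norm_num
  exact Finset.sum_le_sum fun i _ => h2 i

end Oracle

namespace QuantumAlgorithm

variable {n M : ℕ} (A : QuantumAlgorithm n M)

theorem ampNorm_stateAfter (x : Input n M) (k : ℕ) (hk : k < A.queries + 1) :
    ampNorm (A.stateAfter x k hk) = 1 := by
  induction k with
  | zero =>
    rw [stateAfter, ampNorm_mulVec_unitary]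
    refine (sq_eq_sq₀ (ampNorm_nonneg _) zero_le_one).mp ?_
    rw [ampNorm_sq, Finset.sum_eq_single A.start]
    · simp
    · intro s _ hs
      simp [hs]
    · simp
  | succ k ih =>
    rw [stateAfter, ampNorm_mulVec_unitary, ampNorm_oracle, ih]

/-- The probability that query number `k` on input `x` asks for the position `i`. -/
noncomputable def massAt (x : Input n M) (k : ℕ) (i : Fin n) : ℝ :=
  if h : k < A.queries + 1 then queryMass (A.stateAfter x k h) i else 0

theorem massAt_nonneg (x : Input n M) (k : ℕ) (i : Fin n) : 0 ≤ A.massAt x k i := by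
  unfold massAt
  split_ifs
  · exact queryMass_nonneg _ _
  · exact le_rfl

theorem sum_massAt_le (x : Input n M) (k : ℕ) : ∑ i, A.massAt x k i ≤ 1 := by
  unfold massAt
  split_ifs with h
  · refine (sum_queryMass_le _).trans ?_
    rw [A.ampNorm_stateAfter, one_pow]
  · simp

/-- The hybrid argument: each query adds the disagreement of the two oracles on the state of `x`,
and the error accumulated before is preserved by isometries. Only the masses of `x` enter, so the
weights depend on `x` alone. -/
theorem ampNorm_stateAfter_sub_le (x y : Input n M) (k : ℕ) (hk : k < A.queries + 1) :
    ampNorm (A.stateAfter x k hk - A.stateAfter y k hk)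
      ≤ ∑ j ∈ Finset.range k, 2 * √(∑ i ∈ diffSet x y, A.massAt x j i) := by
  induction k with
  | zero =>
    simp [stateAfter, ampNorm]
  | succ k ih =>
    have hk' : k < A.queries + 1 := by omega
    rw [stateAfter, stateAfter, ← Matrix.mulVec_sub, ampNorm_mulVec_unitary,
      Finset.sum_range_succ]
    refine (ampNorm_sub_le _ (oracle y (A.stateAfter x k hk')) _).trans ?_
    rw [oracle_sub y, ampNorm_oracle, add_comm]
    refine add_le_add (ih hk') ?_
    have := ampNorm_oracle_sub_oracle_le x y (A.stateAfter x k hk')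
    simpa only [massAt, dif_pos hk'] using this

/-- Cauchy–Schwarz over the queries merges the square roots at the price of a factor `A.queries`;
this makes the mass quadratic in the number of queries. -/
theorem abs_outputProb_sub_le (x y : Input n M) (b : Bool) :
    |A.outputProb x b - A.outputProb y b| ≤
      4 * √(A.queries * ∑ i ∈ diffSet x y, ∑ j ∈ Finset.range A.queries, A.massAt x j i) := by
  have h1 := abs_sum_sq_sub_le _ _ (A.ampNorm_stateAfter x _ (Nat.lt_succ_self _))
    (A.ampNorm_stateAfter y _ (Nat.lt_succ_self _)) fun s => A.out s = b
  have h2 := A.ampNorm_stateAfter_sub_le x y _ (Nat.lt_succ_self _)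
  have h3 : ∑ j ∈ Finset.range A.queries, √(∑ i ∈ diffSet x y, A.massAt x j i) ≤
      √(A.queries * ∑ i ∈ diffSet x y, ∑ j ∈ Finset.range A.queries, A.massAt x j i) := by
    apply Real.le_sqrt_of_sq_le
    rw [Finset.sum_comm]
    have := Finset.sum_mul_sq_le_sq_mul_sq (Finset.range A.queries) (fun _ => (1 : ℝ))
      fun j => √(∑ i ∈ diffSet x y, A.massAt x j i)
    simp only [one_mul, one_pow, Finset.sum_const, Finset.card_range, nsmul_eq_mul, mul_one] at this
    refine this.trans_eq ?_
    congr 1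
    exact Finset.sum_congr rfl fun j _ =>
      Real.sq_sqrt (Finset.sum_nonneg fun i _ => A.massAt_nonneg x j i)
  rw [← Finset.mul_sum] at h2
  unfold outputProb
  linarith

theorem outputProb_true_add_false (x : Input n M) :
    A.outputProb x true + A.outputProb x false = 1 := by
  unfold outputProb
  rw [← Finset.sum_add_distrib, ← one_pow 2,
    ← A.ampNorm_stateAfter x A.queries (Nat.lt_succ_self _), ampNorm_sq]
  refine Finset.sum_congr rfl fun s _ => ?_
  cases A.out s <;> simp

end QuantumAlgorithm

/-- A quantum algorithm with `q` queries gives query weights of mass `O(q ^ 2)`. -/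
theorem QuantumComputable.queryWeights {n M : ℕ} {X : Set (Input n M)} {f : X → Bool} {q : ℕ}
    (h : QuantumComputable f q) :
    Nonempty (QueryWeights (Subtype.val : X → Input n M) f (2304 * q ^ 2)) := by
  obtain ⟨A, rfl, hA⟩ := h
  exact ⟨{
    p := fun x => A.outputProb x true
    w := fun x i => 2304 * A.queries * ∑ j ∈ Finset.range A.queries, A.massAt x j i
    nonneg := fun x i => mul_nonneg (by positivity)
      (Finset.sum_nonneg fun j _ => A.massAt_nonneg x j i)
    sum_le := fun x => by
      rw [← Finset.mul_sum, Finset.sum_comm]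
      have h1 : ∑ j ∈ Finset.range A.queries, ∑ i, A.massAt x j i ≤ A.queries := by
        simpa using Finset.sum_le_sum fun j (_ : j ∈ Finset.range A.queries) => A.sum_massAt_le x j
      calc 2304 * (A.queries : ℝ) * ∑ j ∈ Finset.range A.queries, ∑ i, A.massAt x j i
          ≤ 2304 * (A.queries : ℝ) * A.queries := by gcongr
        _ = ((2304 * A.queries ^ 2 : ℕ) : ℝ) := by push_cast; ring
    stable := fun x y hxy => by
      rw [← Finset.mul_sum] at hxy
      have h1 := A.abs_outputProb_sub_le x y true
      -- The constant 2304 is 48², and 4 / 48 is the tolerance 1 / 12.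
      have h2 : √(A.queries * ∑ i ∈ diffSet x y, ∑ j ∈ Finset.range A.queries, A.massAt x j i)
          < 1 / 48 := by
        rw [Real.sqrt_lt' (by norm_num)]
        norm_num
        linarith
      linarith
    separated := fun x y hxy => by
      have hx := hA x
      have hy := hA y
      have sx := A.outputProb_true_add_false x
      have sy := A.outputProb_true_add_false y
      rw [le_abs]
      cases hfx : f x <;> cases hfy : f y <;> simp only [hfx, hfy, Bool.not_true, Bool.not_false,
        ne_eq, not_true_eq_false] at hx hy hxy
      · right; linarith
      · left; linarith }⟩

/-! ### Solving for the lower bounds -/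

theorem detComplexity_le {n M : ℕ} {X : Set (Input n M)} {f : X → Bool} {q : ℕ}
    (h : DetComputable f q) : detComplexity f ≤ q :=
  iInf₂_le q h

/-- A polynomial upper bound on `a`, solved for the other quantity. -/
theorem mul_rpow_le_of_le_mul_pow {B q k : ℕ} (hB : 1 ≤ B) (hk : 1 ≤ k) {a : ℕ∞}
    (h : a ≤ ((B * q ^ k : ℕ) : ℕ∞)) :
    (((B : ℝ≥0)⁻¹ : ℝ≥0) : ℝ≥0∞) * (a : ℝ≥0∞) ^ (1 / k : ℝ) ≤ q := by
  have hk0 : (k : ℝ) ≠ 0 := by positivity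
  have h1 : (a : ℝ≥0∞) ≤ (B : ℝ≥0∞) * (q : ℝ≥0∞) ^ k := by
    have := ENat.toENNReal_le.mpr h
    simpa using this
  have hB0 : (B : ℝ≥0) ≠ 0 := by positivity
  calc (((B : ℝ≥0)⁻¹ : ℝ≥0) : ℝ≥0∞) * (a : ℝ≥0∞) ^ (1 / k : ℝ)
      ≤ (((B : ℝ≥0)⁻¹ : ℝ≥0) : ℝ≥0∞) * ((B : ℝ≥0∞) * (q : ℝ≥0∞) ^ k) ^ (1 / k : ℝ) := by
        gcongr
    _ = (((B : ℝ≥0)⁻¹ : ℝ≥0) : ℝ≥0∞) * ((B : ℝ≥0∞) ^ (1 / k : ℝ) * q) := by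
        rw [ENNReal.mul_rpow_of_nonneg _ _ (by positivity), ← ENNReal.rpow_natCast,
          ← ENNReal.rpow_mul, mul_one_div_cancel hk0, ENNReal.rpow_one]
    _ ≤ (((B : ℝ≥0)⁻¹ : ℝ≥0) : ℝ≥0∞) * ((B : ℝ≥0∞) ^ (1 : ℝ) * q) := by
        gcongr
        · exact_mod_cast hB
        · rw [div_le_one (by positivity)]
          exact_mod_cast hk
    _ = q := by
        rw [ENNReal.rpow_one, ← mul_assoc, ENNReal.coe_inv hB0, ENNReal.coe_natCast,
          ENNReal.inv_mul_cancel (by positivity) (ENNReal.natCast_ne_top B), one_mul]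

/-- A lower bound for an infimum of natural numbers may be checked on each of them. -/
theorem le_toENNReal_iInf {P : ℕ → Prop} {a : ℝ≥0∞} (h : ∀ q, P q → a ≤ q) :
    a ≤ ((⨅ (q : ℕ) (_ : P q), (q : ℕ∞) : ℕ∞) : ℝ≥0∞) := by
  classical
  by_cases hP : ∃ q, P q
  · have : (⨅ (q : ℕ) (_ : P q), (q : ℕ∞)) = (Nat.find hP : ℕ∞) := by
      apply le_antisymm
      · exact iInf₂_le _ (Nat.find_spec hP)
      · exact le_iInf₂ fun q hq => by exact_mod_cast Nat.find_min' hP hq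
    rw [this]
    simpa using h _ (Nat.find_spec hP)
  · have : (⨅ (q : ℕ) (_ : P q), (q : ℕ∞)) = ⊤ := by
      simp only [iInf_eq_top]
      exact fun q hq => absurd ⟨q, hq⟩ hP
    rw [this]
    simp

end QueryComplexity

theorem mainTheorem1 :
    ∃ c : ℝ≥0, 0 < c ∧
      ∀ (n M : ℕ) (T : Set (QueryComplexity.Input n M)),
        QueryComplexity.IsTypePromise T →
        ∀ f : T → Bool,
          (c : ℝ≥0∞) * (QueryComplexity.detComplexity f : ℝ≥0∞) ^ (1 / 6 : ℝ)
              ≤ (QueryComplexity.randComplexity f : ℝ≥0∞) ∧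
          (c : ℝ≥0∞) * (QueryComplexity.detComplexity f : ℝ≥0∞) ^ (1 / 12 : ℝ)
              ≤ (QueryComplexity.quantumComplexity f : ℝ≥0∞) := by
  -- The quantum constant; it also covers the randomized case, where 12 replaces 2304.
  obtain ⟨B, hB⟩ : ∃ B : ℕ, B = 3450 * 2304 ^ 6 := ⟨_, rfl⟩
  have hB1 : 1 ≤ B := by rw [hB]; norm_num
  refine ⟨(B : ℝ≥0)⁻¹, by positivity, fun n M T hT f => ⟨?_, ?_⟩⟩
  · refine QueryComplexity.le_toENNReal_iInf fun q hq => ?_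
    obtain ⟨H⟩ := QueryComplexity.RandComputable.queryWeights hq
    have h1 := QueryComplexity.detComplexity_le (H.detComputable hT)
    have h2 : 3450 * (12 * q) ^ 6 ≤ B * q ^ 6 := by
      rw [mul_pow, ← mul_assoc, hB]
      exact Nat.mul_le_mul_right _ (by norm_num)
    have h3 := QueryComplexity.mul_rpow_le_of_le_mul_pow (k := 6) hB1 (by norm_num)
      (h1.trans (by exact_mod_cast h2))
    exact_mod_cast h3
  · refine QueryComplexity.le_toENNReal_iInf fun q hq => ?_
    obtain ⟨H⟩ := QueryComplexity.QuantumComputable.queryWeights hq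
    have h1 := QueryComplexity.detComplexity_le (H.detComputable hT)
    have h2 : 3450 * (2304 * q ^ 2) ^ 6 = B * q ^ 12 := by
      rw [mul_pow, ← mul_assoc, hB, ← pow_mul]
    rw [h2] at h1
    have h3 := QueryComplexity.mul_rpow_le_of_le_mul_pow (k := 12) hB1 (by norm_num) h1
    exact_mod_cast h3
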